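/- **Setting.** Let $(\mathcal A,\psi)$ be a von Neumann algebra with separable predual and a faithful normal state, acting on its GNS Hilbert space $\mathcal H$ with cyclic separating unit vector $\Omega$, $\psi=\langle\Omega,\cdot\,\Omega\rangle$. A *subalgebra* of $(\mathcal A,\psi)$ is a von Neumann subalgebra onto which there is a $\psi$-preserving conditional expectation. Let $\mathcal A_0$ be a subalgebra with conditional expectation $E_0$. An *$\mathcal A_0$-expected continuous Bernoulli shift* consists of a pointwise weak\*-continuous group $(S_t)_{t\in\mathbb R}$ of $\psi$-preserving automorphisms of $\mathcal A$ and a family of subalgebras $\mathcal A_I$, indexed by the intervals $I\subseteq\mathbb R$ (including points and $\emptyset$), such that: $I\subseteq J$ implies $\mathcal A_I\subseteq\mathcal A_J$; the $\mathcal A_I$ with $I$ bounded generate $\mathcal A$; $\mathcal A_0$ is the fixed point algebra of $S$; $S_t\mathcal A_I=\mathcal A_{I+t}$; and, for $I\cap J=\emptyset$, $\mathcal A_I$ and $\mathcal A_J$ are $\mathcal A_0$-independent, i.e. $\mathcal A_0\subseteq\mathcal A_I\cap\mathcal A_J$ and $E_0(xy)=E_0(x)E_0(y)$ for $x\in\mathcal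 A_I$, $y\in\mathcal A_J$. Let $e_0$ be the orthogonal projection onto $\overline{\mathcal A_0\Omega}$, and let $\mathcal E$ (resp. $\mathcal E_I$) be the closure of $\mathcal Ae_0$ (resp. $\mathcal A_Ie_0$) in $\mathcal B(\mathcal H)$ for the strong operator topology, where $x\in\mathcal A$ is mapped to $xe_0$ and $a\in\mathcal A_0$ is identified with $ae_0$ (so $\mathbf 1$ with $e_0$). On $\mathcal E$ put $\langle x|y\rangle_0=x^*y\in\mathcal A_0$, $|x|_0=\langle x|x\rangle_0^{1/2}$, $\|x\|_0=\||x|_0\|$ and $E_0x=\langle\mathbf 1|x\rangle_0$; $S_t$ extends to $\mathcal E$ by $S_t(xe_0)=S_t(x)e_0$. For $x\in\mathcal E_I$, $y\in\mathcal E_J$ with $I,J$ having disjoint interiors, $xy$ is the strong limit of $a_ny$, where $a_n\in\mathcal A_I$ and $a_ne_0\to x$ strongly. A *unital cocycle* is a weak\*-continuous family $u=(u_t)_{t\ge0}\subset\mathcal E$ with $|u_t|_0=\mathbf 1$, $u_t\in\mathcal E_{[0,t]}$ and $u_{t+s}=(S_tu_s)u_t$. An *additive cocycle* is a $\|\cdot\|_0$-continuous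 family $b=(b_t)_{t\ge0}\subset\mathcal E$ with $b_t\in\mathcal E_{[0,t]}$ and $b_{t+s}=b_t+S_tb_s$; it is *centred* if $E_0b_t=0$ for all $t\ge 0$. **Theorem.** Let $u$ be a $\|\cdot\|_0$-continuous unital cocycle. Then there is $K\in\mathcal A_0$ such that $A_t:=E_0u_t=e^{tK}$ for all $t\ge0$, and $\|A_t\|\le1$. For every $t\ge0$ the limits $$b_t=\lim\sum_{i=0}^{n-1}S_{t_i}\big(u_{t_{i+1}-t_i}-\mathbf 1\big),\qquad c_t=\lim\sum_{i=0}^{n-1}S_{t_i}\big(u_{t_{i+1}-t_i}-A_{t_{i+1}-t_i}\big)$$ over the partitions $0=t_0<t_1<\dots<t_n=t$ of $[0,t]$ exist in $\|\cdot\|_0$ as the grid $\max_i(t_{i+1}-t_i)$ tends to $0$. The families $b$ and $c$ are additive cocycles and $c$ is centred. One has $b_t=c_t+tK$ for all $t\ge 0$ and $K=E_0b_1$, and this is the only decomposition $b_t=c'_t+tK'$ with a centred additive cocycle $c'$ and $K'\in\mathcal A_0$. Moreover, for all $t\ge0$, $b$ satisfies the structure equation $$|b_t-E_0b_t|_0^2+E_0b_t+(E_0b_t)^*=0,\quad\text{that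 is,}\quad |b_t-E_0b_t|_0^2+t(E_0b_1)^*+tE_0b_1=0,$$ and $(c,K)$ satisfies the structure equation $|c_t|_0^2+t(K^*+K)=0$. -/

import Mathlib

open Filter Topology Set
open scoped NNReal

noncomputable section

namespace CBS

universe v

section Operators

variable {H : Type v} [NormedAddCommGroup H] [InnerProductSpace ℂ H]

/-- Continuity of an operator-valued function for the weak* (ultraweak) topology: the normal
functionals are those of the form `x ↦ ∑ₙ ⟨ξₙ, x ηₙ⟩` with `∑ ‖ξₙ‖²` and `∑ ‖ηₙ‖²` finite. -/
def WeakStarContinuous {T : Type*} [TopologicalSpace T] (f : T → H →L[ℂ] H) : Prop :=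
  ∀ ξ η : ℕ → H, (Summable fun n => ‖ξ n‖ ^ 2) → (Summable fun n => ‖η n‖ ^ 2) →
    Continuous fun t => ∑' n, inner ℂ (ξ n) (f t (η n))

/-- The closure of a set of bounded operators in the strong operator topology, which is the topology
of pointwise convergence on `H`. -/
def strongClosure (s : Set (H →L[ℂ] H)) : Set (H →L[ℂ] H) :=
  {x | (x : H → H) ∈ closure ((fun y : H →L[ℂ] H => (y : H → H)) '' s)}

variable [CompleteSpace H]

/-- The `A₀`-valued inner product `⟨x|y⟩₀ = x* y`. -/
def inner₀ (x y : H →L[ℂ] H) : H →L[ℂ] H := star x * y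

/-- The operator norm is the Hilbert module norm. -/
theorem norm_eq_sqrt_norm_inner₀ (x : H →L[ℂ] H) : ‖x‖ = Real.sqrt ‖inner₀ x x‖ := by
  rw [inner₀, CStarRing.norm_star_mul_self, Real.sqrt_mul_self (norm_nonneg x)]

end Operators

/-- A noncommutative probability space `(A, ψ)` with separable predual, in its GNS representation:
a von Neumann algebra `A` on a separable Hilbert space `H` with a cyclic and separating unit
vector `Ω`; the faithful normal state is `ψ = ⟨Ω, · Ω⟩`. -/
structure ProbSpace (H : Type v) [NormedAddCommGroup H] [InnerProductSpace ℂ H]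
    [CompleteSpace H] [TopologicalSpace.SeparableSpace H] where
  alg : VonNeumannAlgebra H
  Ω : H
  norm_Ω : ‖Ω‖ = 1
  cyclic : Dense {ξ : H | ∃ x ∈ alg, x Ω = ξ}
  separating : ∀ x ∈ alg, x Ω = 0 → x = 0

variable {H : Type v} [NormedAddCommGroup H] [InnerProductSpace ℂ H]
  [CompleteSpace H] [TopologicalSpace.SeparableSpace H]

/-- The von Neumann algebra `A` as a type of its own. -/
abbrev ProbSpace.Elt (M : ProbSpace H) : Type v := M.alg.toStarSubalgebra

/-- The state `ψ = ⟨Ω, · Ω⟩`. -/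
def ProbSpace.state (M : ProbSpace H) (x : H →L[ℂ] H) : ℂ := inner ℂ M.Ω (x M.Ω)

/-- A conditional expectation of `A` onto `B` which leaves the state invariant: a positive
`B`-bimodule map of `A` onto `B` which is the identity on `B` and preserves `ψ`.  It is unique if it
exists, and it is automatically unital, completely positive and normal. -/
structure CondExp (M : ProbSpace H) (B : VonNeumannAlgebra H) where
  toFun : M.Elt →ₗ[ℂ] M.Elt
  mem : ∀ x, (toFun x : H →L[ℂ] H) ∈ B
  fixes : ∀ x : M.Elt, (x : H →L[ℂ] H) ∈ B → toFun x = x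
  bimodule : ∀ b x c : M.Elt, (b : H →L[ℂ] H) ∈ B → (c : H →L[ℂ] H) ∈ B →
    toFun (b * x * c) = b * toFun x * c
  positive : ∀ x : M.Elt, (toFun (star x * x) : H →L[ℂ] H).IsPositive
  state_eq : ∀ x : M.Elt, M.state (toFun x : H →L[ℂ] H) = M.state (x : H →L[ℂ] H)

/-- A subalgebra of `(A, ψ)`: a von Neumann subalgebra of `A` onto which there is a
state-preserving conditional expectation. -/
def IsSubalgebra (M : ProbSpace H) (B : VonNeumannAlgebra H) : Prop :=
  (B : Set (H →L[ℂ] H)) ⊆ M.alg ∧ Nonempty (CondExp M B)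

/-- An `A₀`-expected noncommutative probability space `(A, ψ, A₀)`. -/
structure ExpectedSpace (H : Type v) [NormedAddCommGroup H] [InnerProductSpace ℂ H]
    [CompleteSpace H] [TopologicalSpace.SeparableSpace H] extends ProbSpace H where
  alg₀ : VonNeumannAlgebra H
  isSubalgebra₀ : IsSubalgebra toProbSpace alg₀

/-- The conditional expectation `E₀` of `A` onto `A₀`. -/
def ExpectedSpace.E₀ (M : ExpectedSpace H) : CondExp M.toProbSpace M.alg₀ :=
  Classical.choice M.isSubalgebra₀.2

/-- `A₀`-independence of two subalgebras: `A₀ ⊆ B ∩ C` and `E₀(xy) = E₀(x)E₀(y)` for `x ∈ B`,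
`y ∈ C`. -/
def ExpectedSpace.Independent (M : ExpectedSpace H) (B C : VonNeumannAlgebra H) : Prop :=
  (M.alg₀ : Set (H →L[ℂ] H)) ⊆ (B : Set (H →L[ℂ] H)) ∩ C ∧
  ∀ x y : M.Elt, (x : H →L[ℂ] H) ∈ B → (y : H →L[ℂ] H) ∈ C →
    M.E₀.toFun (x * y) = M.E₀.toFun x * M.E₀.toFun y

/-- An `A₀`-expected continuous Bernoulli shift.  The filtration `F` is indexed by the intervals
of `ℝ` (bounded or not, degenerate or not, and the empty set), i.e. by the order-connected subsets;
its values at other sets play no role. -/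
structure BernoulliShift (H : Type v) [NormedAddCommGroup H] [InnerProductSpace ℂ H]
    [CompleteSpace H] [TopologicalSpace.SeparableSpace H] extends ExpectedSpace H where
  S : ℝ → (toProbSpace.Elt ≃⋆ₐ[ℂ] toProbSpace.Elt)
  S_state : ∀ t x, toProbSpace.state (S t x : H →L[ℂ] H) = toProbSpace.state (x : H →L[ℂ] H)
  S_add : ∀ s t x, S (s + t) x = S s (S t x)
  S_continuous : ∀ x, WeakStarContinuous fun t => (S t x : H →L[ℂ] H)
  F : Set ℝ → VonNeumannAlgebra H
  F_subalgebra : ∀ I : Set ℝ, I.OrdConnected → IsSubalgebra toProbSpace (F I)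
  F_mono : ∀ I J : Set ℝ, I.OrdConnected → J.OrdConnected → I ⊆ J →
    (F I : Set (H →L[ℂ] H)) ⊆ F J
  /-- minimality: `A` is the von Neumann algebra generated by the `F I`, `I` bounded -/
  F_minimal : Set.centralizer (Set.centralizer
    (⋃ I ∈ {I : Set ℝ | I.OrdConnected ∧ Bornology.IsBounded I}, (F I : Set (H →L[ℂ] H)))) =
      (alg : Set (H →L[ℂ] H))
  fixed : ∀ x : toProbSpace.Elt, (x : H →L[ℂ] H) ∈ alg₀ ↔ ∀ t, S t x = x
  covariant : ∀ (t : ℝ) (I : Set ℝ), I.OrdConnected →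
    {y : H →L[ℂ] H | ∃ x : toProbSpace.Elt, (x : H →L[ℂ] H) ∈ F I ∧ (S t x : H →L[ℂ] H) = y} =
      F ((fun s => s + t) '' I)
  independent : ∀ I J : Set ℝ, I.OrdConnected → J.OrdConnected → I ∩ J = ∅ →
    toExpectedSpace.Independent (F I) (F J)

/-! ### The Hilbert bimodule -/

/-- The orthogonal projection `e₀` onto the closure of `A₀ Ω`, i.e. the GNS implementation of
`E₀`.  As an element of the Hilbert bimodule it is the vector `𝟙`. -/
def ExpectedSpace.e₀ (M : ExpectedSpace H) : H →L[ℂ] H :=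
  (Submodule.span ℂ {ξ : H | ∃ a ∈ M.alg₀, a M.Ω = ξ}).topologicalClosure.starProjection

/-- The Hilbert bimodule of a subalgebra `B ⊇ A₀`: the strong closure of `B e₀` in `B(H)`.
An element `a` of `A₀` is identified with `a e₀`, so that the `A₀`-valued inner product of `x` and
`y` is `x* y` and its norm `‖⟨x|x⟩‖^(1/2)` is the operator norm. -/
def ExpectedSpace.bimod (M : ExpectedSpace H) (B : VonNeumannAlgebra H) : Set (H →L[ℂ] H) :=
  strongClosure {x | ∃ b ∈ B, x = b * M.e₀}

/-- The extension of `E₀` to the bimodule: `E₀ x = ⟨𝟙|x⟩₀ = e₀ x`. -/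
def ExpectedSpace.expect (M : ExpectedSpace H) (x : H →L[ℂ] H) : H →L[ℂ] H := inner₀ M.e₀ x

/-- The product `z = x y` of `x` in the bimodule of `B` with an element `y` of the bimodule of a
subalgebra independent of `B`: the strong limit of `aₙ y`, where `aₙ ∈ B` is a sequence
such that `aₙ e₀` tends to `x` strongly. (The limit does not depend on the sequence.) -/
def ExpectedSpace.IsProduct (M : ExpectedSpace H) (B : VonNeumannAlgebra H)
    (x y z : H →L[ℂ] H) : Prop :=
  ∃ a : ℕ → H →L[ℂ] H, (∀ n, a n ∈ B) ∧
    (∀ ξ : H, Tendsto (fun n => (a n * M.e₀) ξ) atTop (𝓝 (x ξ))) ∧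
    (∀ ξ : H, Tendsto (fun n => (a n * y) ξ) atTop (𝓝 (z ξ)))

/-- The GNS map `x ↦ x Ω`. -/
def ProbSpace.gnsMap (M : ProbSpace H) : M.Elt →ₗ[ℂ] H where
  toFun x := (x : H →L[ℂ] H) M.Ω
  map_add' _ _ := rfl
  map_smul' _ _ := rfl

/-- The unitary `U_t` on `H` which implements `S_t`: the bounded extension of `x Ω ↦ S_t(x) Ω`. -/
def BernoulliShift.U (M : BernoulliShift H) (t : ℝ) : H →L[ℂ] H :=
  (M.gnsMap ∘ₗ (M.S t).toAlgEquiv.toLinearMap).extendOfNorm M.gnsMap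

/-- The extension of the shift to the bimodule: left multiplication by `U_t`. -/
def BernoulliShift.shift (M : BernoulliShift H) (t : ℝ) (x : H →L[ℂ] H) : H →L[ℂ] H :=
  M.U t * x

theorem BernoulliShift.U_apply (M : BernoulliShift H) (t : ℝ) (x : M.Elt) :
    M.U t ((x : H →L[ℂ] H) M.Ω) = (M.S t x : H →L[ℂ] H) M.Ω := by
  have key : ∀ y : M.Elt,
      M.state ((star y * y : M.Elt) : H →L[ℂ] H) = (‖(y : H →L[ℂ] H) M.Ω‖ : ℂ) ^ 2 := by
    intro y
    have h1 : ((star y * y : M.Elt) : H →L[ℂ] H) =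
        star (y : H →L[ℂ] H) * (y : H →L[ℂ] H) := rfl
    rw [ProbSpace.state, h1, mul_apply_eq_comp, ContinuousLinearMap.star_eq_adjoint,
      ContinuousLinearMap.adjoint_inner_right, inner_self_eq_norm_sq_to_K]
    rfl
  refine LinearMap.extendOfNorm_eq (e := M.gnsMap) ?_ ⟨1, fun y => ?_⟩ x
  · have := M.cyclic
    rw [DenseRange]
    convert this using 1
    ext ξ
    constructor
    · rintro ⟨y, rfl⟩
      exact ⟨y, y.2, rfl⟩
    · rintro ⟨y, hy, rfl⟩
      exact ⟨⟨y, hy⟩, rfl⟩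
  · have h := M.S_state t (star y * y)
    rw [map_mul, map_star, key, key] at h
    have h2 : ‖(M.S t y : H →L[ℂ] H) M.Ω‖ ^ 2 = ‖(y : H →L[ℂ] H) M.Ω‖ ^ 2 := by
      exact_mod_cast h
    have h3 := (sq_eq_sq₀ (norm_nonneg _) (norm_nonneg _)).1 h2
    rw [one_mul]
    exact h3.le

/-- `shift` extends the automorphisms `S_t` of `A` under the embedding `x ↦ x e₀`. -/
theorem BernoulliShift.shift_apply (M : BernoulliShift H) (t : ℝ) (x : M.Elt) :
    M.shift t ((x : H →L[ℂ] H) * M.e₀) = (M.S t x : H →L[ℂ] H) * M.e₀ := by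
  have hcl : ∀ ξ ∈ (Submodule.span ℂ
      {ξ : H | ∃ a ∈ M.alg₀, a M.Ω = ξ}).topologicalClosure,
      M.U t ((x : H →L[ℂ] H) ξ) = (M.S t x : H →L[ℂ] H) ξ := by
    intro ξ hξ
    have hle : (Submodule.span ℂ {ξ : H | ∃ a ∈ M.alg₀, a M.Ω = ξ}) ≤
        (M.U t * (x : H →L[ℂ] H)).eqLocus (M.S t x : H →L[ℂ] H) := by
      rw [Submodule.span_le]
      rintro _ ⟨a, ha, rfl⟩
      have h1 := M.U_apply t (x * ⟨a, M.isSubalgebra₀.1 ha⟩)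
      rw [map_mul, (M.fixed ⟨a, M.isSubalgebra₀.1 ha⟩).1 ha t] at h1
      exact h1
    exact Submodule.topologicalClosure_minimal _ hle
      (isClosed_eq (M.U t * (x : H →L[ℂ] H)).continuous (M.S t x : H →L[ℂ] H).continuous) hξ
  ext ξ
  exact hcl _ (Submodule.starProjection_apply_mem _ ξ)

/-! ### Cocycles -/

/-- A unital cocycle of the GNS Bernoulli shift.  `|u_t|₀ = 𝟙` reads `⟨u_t|u_t⟩₀ = e₀`. -/
structure BernoulliShift.IsUnitalCocycle (M : BernoulliShift H) (u : ℝ≥0 → H →L[ℂ] H) :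
    Prop where
  continuous : WeakStarContinuous u
  unital : ∀ t, inner₀ (u t) (u t) = M.e₀
  adapted : ∀ t : ℝ≥0, u t ∈ M.bimod (M.F (Icc 0 (t : ℝ)))
  cocycle : ∀ s t : ℝ≥0, M.IsProduct (M.F (Icc (t : ℝ) (t + s)))
    (M.shift t (u s)) (u t) (u (t + s))

/-- An additive cocycle of the GNS Bernoulli shift. -/
structure BernoulliShift.IsAdditiveCocycle (M : BernoulliShift H) (b : ℝ≥0 → H →L[ℂ] H) :
    Prop where
  continuous : Continuous b
  adapted : ∀ t : ℝ≥0, b t ∈ M.bimod (M.F (Icc 0 (t : ℝ)))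
  cocycle : ∀ s t : ℝ≥0, b (t + s) = b t + M.shift t (b s)

/-- A centred additive cocycle. -/
def BernoulliShift.IsCentredAdditiveCocycle (M : BernoulliShift H) (c : ℝ≥0 → H →L[ℂ] H) :
    Prop :=
  M.IsAdditiveCocycle c ∧ ∀ t, M.expect (c t) = 0

/-- The structure equation `⟨b - E₀b | b - E₀b⟩₀ + E₀b + (E₀b)* = 0`. -/
def BernoulliShift.StructureEquation (M : BernoulliShift H) (b : ℝ≥0 → H →L[ℂ] H) : Prop :=
  ∀ t, inner₀ (b t - M.expect (b t)) (b t - M.expect (b t)) + M.expect (b t)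
    + star (M.expect (b t)) = 0

/-- A partition `0 = t₀ < t₁ < … < tₙ = t` of `[0, t]`. -/
structure Partition (t : ℝ≥0) where
  n : ℕ
  pt : Fin (n + 1) → ℝ≥0
  strictMono : StrictMono pt
  pt_zero : pt 0 = 0
  pt_last : pt (Fin.last n) = t

/-- The length `t_{i+1} - t_i` of a subinterval. -/
def Partition.step {t : ℝ≥0} (Z : Partition t) (i : Fin Z.n) : ℝ≥0 :=
  Z.pt i.succ - Z.pt i.castSucc

/-- The grid `max (t_{i+1} - t_i)` of a partition. -/
def Partition.mesh {t : ℝ≥0} (Z : Partition t) : ℝ≥0 := Finset.univ.sup Z.step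

/-- The filter "the grid tends to zero" on the partitions of `[0, t]`. -/
def fine (t : ℝ≥0) : Filter (Partition t) := comap Partition.mesh (𝓝 0)

/-- The Riemann sum `∑ S_{t_i}(u_{t_{i+1} - t_i} - 𝟙)`. -/
def BernoulliShift.logSum (M : BernoulliShift H) (u : ℝ≥0 → H →L[ℂ] H) {t : ℝ≥0}
    (Z : Partition t) : H →L[ℂ] H :=
  ∑ i, M.shift (Z.pt i.castSucc) (u (Z.step i) - M.e₀)

/-- The Riemann sum `∑ S_{t_i}(u_{t_{i+1} - t_i} - A_{t_{i+1} - t_i})`, where `A_s = E₀ u_s`. -/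
def BernoulliShift.centredLogSum (M : BernoulliShift H) (u : ℝ≥0 → H →L[ℂ] H) {t : ℝ≥0}
    (Z : Partition t) : H →L[ℂ] H :=
  ∑ i, M.shift (Z.pt i.castSucc) (u (Z.step i) - M.expect (u (Z.step i)))

end CBS

end

/-!
The expectation `A_t = E₀ u_t` of a norm continuous unital cocycle is a norm continuous contraction
semigroup, because `E₀(xy) = E₀(x) E₀(y)` for the factors of `u_{t+s} = (S_t u_s) u_t`; hence
`A_t = e^{tK}` (`exists_generator`, `exists_expect_eq_exp`). It remains to treat the centred part
`v_t = u_t - A_t`, which is of order `√t`.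

Independence is used in operator form. Let `e_I` be the projection onto the closure of `A_I Ω`. If
`J` follows `I`, then `e_I x e_I = E₀(x) e_I` for `x ∈ A_J` (`past_compress`); adjacent closed
intervals are reached from disjoint ones by a small shift. So centred elements of the bimodule of
`J` are orthogonal to the bimodule of `I` (`star_mul_shift_eq_zero`), sums of centred increments
obey Pythagoras' inequality, and `‖xy‖ ≤ ‖x‖ ‖y‖` for products of independent elements
(`IsProduct.norm_le`). The last fact and the existence of `A_t` as an element of `A₀` depend on the
strong closedness of the corner `A₀ e₀` (`exists_mul_gnsProj_eq`).

The cocycle identity gives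
`v_{s+t} - v_s - S_s v_t = (S_s v_t) v_s + S_s v_t (A_s - 1) + (A_t - 1) v_s`,
which is `O(s + t)` (`centredPart_estimates`). A family of centred increments with this property is
within `O(t)` of a unique additive one (`exists_additive`): replacing `x_t` by
`x_{t/2} + S_{t/2} x_{t/2}` is, by orthogonality, a contraction with factor `1/√2` for the norm
`sup ‖x_t‖ / t`; the limit `c` is additive on commensurable times by the uniqueness of such limits
and on all times by strong continuity. A Riemann sum of `v` differs from `c_t` by orthogonal errors
of norm `O(h_i)` on the subintervals, hence by `O(√(mesh))` in norm (`tendsto_riemann_sum`), and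
`b_t = c_t + tK`. Finally `c_t^* c_t` is additive in `t` and agrees with
`v_t^* v_t = 1 - A_t^* A_t` up to `o(t)`, which gives the structure equations
(`star_mul_add_eq_zero`).
-/

/-! ### Projections onto cyclic subspaces -/

namespace CBS

section Projection

variable {H : Type*} [NormedAddCommGroup H] [InnerProductSpace ℂ H]
  [CompleteSpace H] [TopologicalSpace.SeparableSpace H]

/-- The orthogonal projection onto the closure of `B Ω`; for `B = A₀` it is `e₀`, and for the
algebra of an interval it is the projection onto the past belonging to that interval. -/
noncomputable def ProbSpace.gnsProj (M : ProbSpace H) (B : VonNeumannAlgebra H) : H →L[ℂ] H :=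
  (Submodule.span ℂ {ξ : H | ∃ a ∈ B, a M.Ω = ξ}).topologicalClosure.starProjection

namespace ProbSpace

variable (M : ProbSpace H) (B : VonNeumannAlgebra H)

theorem isStarProjection_gnsProj : IsStarProjection (M.gnsProj B) :=
  isStarProjection_starProjection

theorem star_gnsProj : star (M.gnsProj B) = M.gnsProj B :=
  (M.isStarProjection_gnsProj B).isSelfAdjoint

theorem gnsProj_mul_self : M.gnsProj B * M.gnsProj B = M.gnsProj B :=
  (M.isStarProjection_gnsProj B).isIdempotentElem

theorem norm_gnsProj_le : ‖M.gnsProj B‖ ≤ 1 :=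
  Submodule.starProjection_norm_le _

variable {B}

theorem gnsProj_apply {b : H →L[ℂ] H} (hb : b ∈ B) : M.gnsProj B (b M.Ω) = b M.Ω := by
  rw [gnsProj, Submodule.starProjection_eq_self_iff]
  exact Submodule.le_topologicalClosure _ (Submodule.subset_span ⟨b, hb, rfl⟩)

theorem gnsProj_Ω : M.gnsProj B M.Ω = M.Ω := by
  simpa using M.gnsProj_apply (one_mem B)

/-- Two operators which agree on `B Ω` agree on the range of its projection. -/
theorem apply_gnsProj_ext {F : Type*} [NormedAddCommGroup F] [NormedSpace ℂ F] {x y : H →L[ℂ] F}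
    (h : ∀ b ∈ B, x (b M.Ω) = y (b M.Ω)) (ξ : H) : x (M.gnsProj B ξ) = y (M.gnsProj B ξ) := by
  have hle : (Submodule.span ℂ {ξ : H | ∃ a ∈ B, a M.Ω = ξ}) ≤ x.eqLocus y := by
    rw [Submodule.span_le]
    rintro _ ⟨a, ha, rfl⟩
    exact h a ha
  exact Submodule.topologicalClosure_minimal _ hle (isClosed_eq x.continuous y.continuous)
    (Submodule.starProjection_apply_mem _ ξ)

theorem mul_gnsProj_ext {x y : H →L[ℂ] H} (h : ∀ b ∈ B, x (b M.Ω) = y (b M.Ω)) :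
    x * M.gnsProj B = y * M.gnsProj B :=
  ContinuousLinearMap.ext fun ξ => M.apply_gnsProj_ext h ξ

theorem commute_gnsProj {b : H →L[ℂ] H} (hb : b ∈ B) : b * M.gnsProj B = M.gnsProj B * b := by
  have key : ∀ c ∈ B, M.gnsProj B * c * M.gnsProj B = c * M.gnsProj B := by
    intro c hc
    refine M.mul_gnsProj_ext fun a ha => ?_
    exact M.gnsProj_apply (mul_mem hc ha)
  have h1 := congrArg star (key (star b) (star_mem hb))
  simp only [star_mul, star_star, star_gnsProj] at h1
  rw [← key b hb, mul_assoc, h1]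

theorem state_star_mul (x y : H →L[ℂ] H) :
    M.state (star x * y) = inner ℂ (x M.Ω) (y M.Ω) := by
  rw [state, mul_apply_eq_comp, ContinuousLinearMap.star_eq_adjoint,
    ContinuousLinearMap.adjoint_inner_right]

/-- Operators whose matrix elements agree on `B Ω` have the same compression to its closure. -/
theorem gnsProj_mul_mul_ext {x y : H →L[ℂ] H}
    (h : ∀ a ∈ B, ∀ b ∈ B, inner ℂ (a M.Ω) (x (b M.Ω)) = inner ℂ (a M.Ω) (y (b M.Ω))) :
    M.gnsProj B * x * M.gnsProj B = M.gnsProj B * y * M.gnsProj B := by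
  refine M.mul_gnsProj_ext fun b hb => ?_
  rw [mul_apply_eq_comp, mul_apply_eq_comp, ← sub_eq_zero, ← map_sub]
  have h1 : ∀ ξ, innerSL ℂ (x (b M.Ω) - y (b M.Ω)) (M.gnsProj B ξ) =
      (0 : H →L[ℂ] ℂ) (M.gnsProj B ξ) := by
    refine M.apply_gnsProj_ext fun a ha => ?_
    rw [innerSL_apply_apply, ← inner_conj_symm, inner_sub_right, h a ha b hb]
    simp
  refine ext_inner_right ℂ fun ξ => ?_
  have h2 := h1 ξ
  rw [innerSL_apply_apply] at h2
  rw [← M.star_gnsProj, ContinuousLinearMap.star_eq_adjoint,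
    ContinuousLinearMap.adjoint_inner_left, h2]
  simp

/-- The projection implements the conditional expectation: `e x e = E(x) e`. -/
theorem gnsProj_compress (hB : (B : Set (H →L[ℂ] H)) ⊆ M.alg) (E : CondExp M B) (x : M.Elt) :
    M.gnsProj B * (x : H →L[ℂ] H) * M.gnsProj B = (E.toFun x : H →L[ℂ] H) * M.gnsProj B := by
  have h : M.gnsProj B * (x : H →L[ℂ] H) * M.gnsProj B =
      M.gnsProj B * (E.toFun x : H →L[ℂ] H) * M.gnsProj B := by
    refine M.gnsProj_mul_mul_ext fun a ha b hb => ?_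
    have h1 := E.state_eq (star ⟨a, hB ha⟩ * x * ⟨b, hB hb⟩)
    rw [E.bimodule _ _ _ (star_mem ha) hb] at h1
    have h2 : ∀ z : M.Elt, M.state ((star ⟨a, hB ha⟩ * z * ⟨b, hB hb⟩ : M.Elt) : H →L[ℂ] H) =
        inner ℂ (a M.Ω) ((z : H →L[ℂ] H) (b M.Ω)) := by
      intro z
      rw [mul_assoc]
      exact M.state_star_mul a ((z : H →L[ℂ] H) * b)
    rw [h2, h2] at h1
    exact h1.symm
  rw [h, ← M.commute_gnsProj (E.mem x), mul_assoc, gnsProj_mul_self]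

/-- The vector `Ω` is cyclic for the commutant of `A`, since it is separating for `A`. -/
theorem gnsProj_commutant (hB : (B : Set (H →L[ℂ] H)) ⊆ M.alg) : M.gnsProj B.commutant = 1 := by
  have hle : ∀ x ∈ M.alg.commutant, x ∈ B.commutant := by
    intro x hx
    rw [VonNeumannAlgebra.mem_commutant_iff] at hx ⊢
    exact fun g hg => hx g (hB hg)
  have h1 : M.gnsProj B.commutant ∈ M.alg := by
    rw [← M.alg.commutant_commutant, VonNeumannAlgebra.mem_commutant_iff]
    exact fun g hg => M.commute_gnsProj (hle g hg)
  have h2 := M.separating (1 - M.gnsProj B.commutant) (sub_mem (one_mem _) h1) (by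
    simp [M.gnsProj_Ω])
  exact (sub_eq_zero.1 h2).symm

theorem dense_commutant (hB : (B : Set (H →L[ℂ] H)) ⊆ M.alg) :
    Dense {ξ : H | ∃ a ∈ B.commutant, a M.Ω = ξ} := by
  have h1 : ∀ ξ, ξ ∈ (Submodule.span ℂ
      {ξ : H | ∃ a ∈ B.commutant, a M.Ω = ξ}).topologicalClosure := by
    intro ξ
    have h2 := congrArg (fun x : H →L[ℂ] H => x ξ) (M.gnsProj_commutant hB)
    exact Submodule.starProjection_eq_self_iff.1 h2
  have h2 : (Submodule.span ℂ {ξ : H | ∃ a ∈ B.commutant, a M.Ω = ξ} : Set H) ⊆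
      {ξ : H | ∃ a ∈ B.commutant, a M.Ω = ξ} := by
    intro ξ hξ
    induction hξ using Submodule.span_induction with
    | mem ξ h => exact h
    | zero => exact ⟨0, zero_mem _, by simp⟩
    | add ξ η _ _ h1 h2 =>
      obtain ⟨a, ha, rfl⟩ := h1
      obtain ⟨b, hb, rfl⟩ := h2
      exact ⟨a + b, add_mem ha hb, rfl⟩
    | smul r ξ _ h1 =>
      obtain ⟨a, ha, rfl⟩ := h1
      exact ⟨r • a, B.commutant.toStarSubalgebra.smul_mem ha r, rfl⟩
  intro ξ
  exact closure_mono h2 (h1 ξ)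

/-- An element of `A₀` is determined by its restriction to the closure of `A₀ Ω`. -/
theorem eq_of_mul_gnsProj_eq (hB : (B : Set (H →L[ℂ] H)) ⊆ M.alg) {x y : H →L[ℂ] H}
    (hx : x ∈ B) (hy : y ∈ B) (h : x * M.gnsProj B = y * M.gnsProj B) : x = y := by
  have h1 := congrArg (fun z : H →L[ℂ] H => z M.Ω) h
  simp only [mul_apply_eq_comp, M.gnsProj_Ω] at h1
  exact sub_eq_zero.1 (M.separating _ (hB (sub_mem hx hy)) (by simp [h1]))

/-- The corner of `B` at its GNS projection is strongly closed: an operator of the corner which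
commutes with the compressed commutant is the restriction of an element of `B`.  This element is
`x' Ω ↦ x' T Ω` for `x'` in the commutant, bounded because `T` commutes with the square root of the
compression of `x'^* x'`. -/
theorem exists_mul_gnsProj_eq (hB : (B : Set (H →L[ℂ] H)) ⊆ M.alg) {T : H →L[ℂ] H}
    (hT : M.gnsProj B * T = T) (hT' : T * M.gnsProj B = T)
    (hc : ∀ x ∈ B.commutant, T * (M.gnsProj B * x * M.gnsProj B) =
      M.gnsProj B * x * M.gnsProj B * T) :
    ∃ a ∈ B, a * M.gnsProj B = T ∧ ‖a‖ ≤ ‖T‖ := by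
  set e := M.gnsProj B with he
  have hΩ : e M.Ω = M.Ω := M.gnsProj_Ω
  let C := B.commutant.toStarSubalgebra
  let E : C →ₗ[ℂ] H :=
    { toFun := fun x => (x : H →L[ℂ] H) M.Ω
      map_add' := fun _ _ => rfl
      map_smul' := fun _ _ => rfl }
  let f : C →ₗ[ℂ] H :=
    { toFun := fun x => (x : H →L[ℂ] H) (T M.Ω)
      map_add' := fun _ _ => rfl
      map_smul' := fun _ _ => rfl }
  have hE : DenseRange E := by
    have h := M.dense_commutant hB
    rw [DenseRange]
    convert h using 1
    ext ξ
    constructor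
    · rintro ⟨y, rfl⟩
      exact ⟨y, y.2, rfl⟩
    · rintro ⟨y, hy, rfl⟩
      exact ⟨⟨y, hy⟩, rfl⟩
  have hTe : ∀ ξ, e (T ξ) = T ξ := fun ξ => congrArg (fun x : H →L[ℂ] H => x ξ) hT
  have hbd : ∀ x : C, ‖f x‖ ≤ ‖T‖ * ‖E x‖ := by
    intro x
    -- `k = |x' e|` commutes with `T` and `‖k ξ‖ = ‖x' e ξ‖`
    set y : H →L[ℂ] H := (x : H →L[ℂ] H) * e with hy
    have hpos : 0 ≤ star y * y := star_mul_self_nonneg y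
    have hcomm : T * (star y * y) = star y * y * T := by
      have h1 : star y * y = e * (star (x : H →L[ℂ] H) * x) * e := by
        rw [hy, star_mul, he, M.star_gnsProj]
        simp only [mul_assoc]
      rw [h1]
      exact hc _ (mul_mem (star_mem x.2) x.2)
    set k := CFC.sqrt (star y * y) with hk
    have hks : star k = k := (CFC.sqrt_nonneg _).isSelfAdjoint
    have hkk : star k * k = star y * y := by rw [hks]; exact CFC.sqrt_mul_sqrt_self _ hpos
    have hkT : T * k = k * T := by
      have : Commute (star y * y) T := hcomm.symm
      exact (this.cfcₙ_nnreal NNReal.sqrt).symm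
    have hnorm : ∀ ξ, ‖k ξ‖ = ‖y ξ‖ := by
      intro ξ
      have h : ∀ z : H →L[ℂ] H, ‖z ξ‖ ^ 2 = RCLike.re (inner ℂ ξ ((star z * z) ξ)) := by
        intro z
        rw [mul_apply_eq_comp, ContinuousLinearMap.star_eq_adjoint,
          ContinuousLinearMap.adjoint_inner_right, inner_self_eq_norm_sq]
      refine (sq_eq_sq₀ (norm_nonneg _) (norm_nonneg _)).1 ?_
      rw [h, h, hkk]
    have h1 : f x = y (T M.Ω) := by
      change (x : H →L[ℂ] H) (T M.Ω) = (x : H →L[ℂ] H) (e (T M.Ω))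
      rw [hTe]
    have h2 : E x = y M.Ω := by
      change (x : H →L[ℂ] H) M.Ω = (x : H →L[ℂ] H) (e M.Ω)
      rw [hΩ]
    rw [h1, h2, ← hnorm, ← hnorm]
    have h3 : k (T M.Ω) = T (k M.Ω) := congrArg (fun z : H →L[ℂ] H => z M.Ω) hkT.symm
    rw [h3]
    exact T.le_opNorm _
  set a := f.extendOfNorm E with ha
  have haE : ∀ x ∈ B.commutant, a (x M.Ω) = x (T M.Ω) := fun x hx =>
    LinearMap.extendOfNorm_eq hE ⟨_, hbd⟩ ⟨x, hx⟩
  have hdense : ∀ x y : H →L[ℂ] H, (∀ b ∈ B.commutant, x (b M.Ω) = y (b M.Ω)) → x = y := by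
    intro x y h
    have := M.mul_gnsProj_ext h
    rwa [M.gnsProj_commutant hB, mul_one, mul_one] at this
  have hacomm : ∀ g ∈ B.commutant, g * a = a * g := by
    intro g hg
    refine hdense _ _ fun b hb => ?_
    change g (a (b M.Ω)) = a ((g * b) M.Ω)
    rw [haE b hb, haE _ (mul_mem hg hb)]
    rfl
  have haB : a ∈ B := by
    rw [← B.commutant_commutant, VonNeumannAlgebra.mem_commutant_iff]
    exact hacomm
  refine ⟨a, haB, ?_, LinearMap.opNorm_extendOfNorm_le hE (norm_nonneg _) hbd⟩
  refine hdense _ _ fun b hb => ?_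
  have h1 : a * e = e * a := M.commute_gnsProj haB
  rw [h1]
  change e (a (b M.Ω)) = T (b M.Ω)
  have h2 := congrArg (fun x : H →L[ℂ] H => x M.Ω) (hc b hb)
  simp only [mul_apply_eq_comp, hΩ, hTe] at h2
  rw [haE b hb, ← h2]
  exact congrArg (fun x : H →L[ℂ] H => x (b M.Ω)) hT'

end ProbSpace

end Projection
end CBS

/-! ### Norm continuous semigroups in a Banach algebra -/

namespace CBS

section Semigroup

variable {A : Type*} [NormedRing A] [NormedAlgebra ℂ A] [CompleteSpace A]

theorem hasDerivAt_exp_smul (K : A) (t : ℝ) :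
    HasDerivAt (fun s : ℝ => NormedSpace.exp ((s : ℂ) • K))
      (NormedSpace.exp ((t : ℂ) • K) * K) t :=
  by simpa [Function.comp_def] using
    (hasDerivAt_exp_smul_const K (t : ℂ)).scomp t Complex.ofRealCLM.hasDerivAt

/-- If `e^{tK}` is contractive for `t ≥ 0`, then `‖e^{tK} - 1‖ ≤ t ‖K‖`. -/
theorem norm_exp_smul_sub_one_le {K : A}
    (hK : ∀ t : ℝ, 0 ≤ t → ‖NormedSpace.exp ((t : ℂ) • K)‖ ≤ 1) {t : ℝ} (ht : 0 ≤ t) :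
    ‖NormedSpace.exp ((t : ℂ) • K) - 1‖ ≤ t * ‖K‖ := by
  have h := norm_image_sub_le_of_norm_deriv_right_le_segment (a := 0) (b := t)
    (f := fun s : ℝ => NormedSpace.exp ((s : ℂ) • K)) (C := ‖K‖)
    (fun s _ => (hasDerivAt_exp_smul K s).continuousAt.continuousWithinAt)
    (fun s _ => (hasDerivAt_exp_smul K s).hasDerivWithinAt)
    (fun s hs => (norm_mul_le _ _).trans
      (mul_le_of_le_one_left (norm_nonneg _) (hK s hs.1)))
    t ⟨ht, le_rfl⟩
  simpa [mul_comm] using h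

theorem norm_exp_smul_sub_one_sub_le {K : A}
    (hK : ∀ t : ℝ, 0 ≤ t → ‖NormedSpace.exp ((t : ℂ) • K)‖ ≤ 1) {t : ℝ} (ht : 0 ≤ t) :
    ‖NormedSpace.exp ((t : ℂ) • K) - 1 - (t : ℂ) • K‖ ≤ ‖K‖ ^ 2 * t ^ 2 := by
  have hd : ∀ s : ℝ, HasDerivAt (fun s : ℝ => NormedSpace.exp ((s : ℂ) • K) - 1 - (s : ℂ) • K)
      (NormedSpace.exp ((s : ℂ) • K) * K - K) s := by
    intro s
    have h1 : HasDerivAt (fun s : ℝ => (s : ℂ) • K) K s := by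
      simpa using (Complex.ofRealCLM.hasDerivAt (x := s)).smul_const K
    exact ((hasDerivAt_exp_smul K s).sub_const 1).sub h1
  have h := norm_image_sub_le_of_norm_deriv_right_le_segment (a := 0) (b := t)
    (C := t * ‖K‖ * ‖K‖)
    (fun s _ => (hd s).continuousAt.continuousWithinAt)
    (fun s _ => (hd s).hasDerivWithinAt)
    (fun s hs => by
      have h2 := norm_exp_smul_sub_one_le hK hs.1
      have h3 : NormedSpace.exp ((s : ℂ) • K) * K - K =
        (NormedSpace.exp ((s : ℂ) • K) - 1) * K := by rw [sub_mul, one_mul]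
      rw [h3]
      refine (norm_mul_le _ _).trans ?_
      gcongr
      exact h2.trans (by gcongr; exact hs.2.le))
    t ⟨ht, le_rfl⟩
  simp only [Complex.ofReal_zero, zero_smul, NormedSpace.exp_zero, sub_self, sub_zero] at h
  exact h.trans_eq (by ring)

/-- A norm continuous one-parameter semigroup in a Banach algebra is `e^{tK}`, and its generator
`K` belongs to every closed subspace which contains the semigroup.  With `V = ∫₀^τ α`, invertible
for small `τ`, the function `α V` is an integral of `α`, so `α` is differentiable. -/
theorem exists_generator {α : ℝ≥0 → A} (hα : Continuous α) (h0 : α 0 = 1)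
    (hadd : ∀ s t, α (s + t) = α s * α t) :
    ∃ K : A, (∀ t : ℝ≥0, α t = NormedSpace.exp (((t : ℝ) : ℂ) • K)) ∧
      ∀ B : Submodule ℂ A, IsClosed (B : Set A) → (∀ t, α t ∈ B) → K ∈ B := by
  set f : ℝ → A := fun t => α t.toNNReal with hf
  have hfc : Continuous f := hα.comp continuous_real_toNNReal
  have hf0 : f 0 = 1 := by simp [hf, h0]
  have hfadd : ∀ s t : ℝ, 0 ≤ s → 0 ≤ t → f (s + t) = f s * f t := by
    intro s t hs ht
    rw [hf]; simp only [Real.toNNReal_add hs ht, hadd]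
  -- `τ⁻¹ ∫₀^τ α` is close to `1` for small `τ`
  obtain ⟨τ, hτ, hV⟩ : ∃ τ : ℝ, 0 < τ ∧ IsUnit (∫ s in (0:ℝ)..τ, f s) := by
    have h1 : ∀ᶠ s in 𝓝 (0:ℝ), ‖f s - 1‖ < 1 / 2 := by
      have := (hfc.tendsto 0)
      rw [hf0] at this
      have h2 := this.sub_const 1
      rw [sub_self] at h2
      simpa using h2.norm.eventually_lt_const (by simp : ‖(0:A)‖ < 1/2)
    obtain ⟨δ, hδ, h2⟩ := Metric.eventually_nhds_iff.1 h1
    refine ⟨δ / 2, by positivity, ?_⟩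
    have h3 : ‖(∫ s in (0:ℝ)..(δ/2), f s) - (δ / 2) • (1 : A)‖ ≤ 1 / 2 * |δ / 2 - 0| := by
      have h4 : (∫ s in (0:ℝ)..(δ/2), f s) - (δ / 2) • (1 : A) =
          ∫ s in (0:ℝ)..(δ/2), (f s - 1) := by
        rw [intervalIntegral.integral_sub (hfc.intervalIntegrable _ _)
          (continuous_const.intervalIntegrable _ _)]
        simp
      rw [h4]
      refine intervalIntegral.norm_integral_le_of_norm_le_const fun s hs => ?_
      rw [Set.uIoc_of_le (by positivity)] at hs
      exact (h2 (by rw [Real.dist_eq, sub_zero, abs_of_pos hs.1]; linarith [hs.2])).le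
    have hr : (0:ℝ) < δ / 2 := by positivity
    set r := δ / 2 with hrdef
    set V := ∫ s in (0:ℝ)..r, f s
    have h5 : ‖1 - r⁻¹ • V‖ < 1 := by
      have h6 : 1 - r⁻¹ • V = -(r⁻¹ • (V - r • (1 : A))) := by
        rw [smul_sub, smul_smul, inv_mul_cancel₀ hr.ne', one_smul, neg_sub]
      rw [h6, norm_neg, norm_smul, norm_inv, Real.norm_of_nonneg hr.le]
      rw [sub_zero, abs_of_pos hr] at h3
      calc r⁻¹ * ‖V - r • (1 : A)‖ ≤ r⁻¹ * (1 / 2 * r) := by gcongr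
        _ = 1 / 2 := by field_simp
        _ < 1 := by norm_num
    have h7 := isUnit_one_sub_of_norm_lt_one h5
    rw [sub_sub_cancel] at h7
    have h8 : V = (r • (1 : A)) * (r⁻¹ • V) := by
      rw [smul_mul_smul_comm, mul_inv_cancel₀ hr.ne', one_smul, one_mul]
    rw [h8]
    refine IsUnit.mul ?_ h7
    rw [← Algebra.algebraMap_eq_smul_one]
    exact (isUnit_iff_ne_zero.2 hr.ne').map (algebraMap ℝ A)
  obtain ⟨V, hVeq⟩ := hV
  set W : A := ↑V⁻¹ with hW
  set g : ℝ → A := fun t => ((∫ s in (0:ℝ)..(t + τ), f s) - ∫ s in (0:ℝ)..t, f s) * W with hg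
  have hgf : ∀ t, 0 ≤ t → g t = f t := by
    intro t ht
    have h1 : (∫ s in (0:ℝ)..(t + τ), f s) - ∫ s in (0:ℝ)..t, f s = f t * V := by
      rw [intervalIntegral.integral_interval_sub_left (hfc.intervalIntegrable _ _)
        (hfc.intervalIntegrable _ _), hVeq]
      have h2 : ∫ s in t..(t + τ), f s = ∫ s in (0:ℝ)..τ, f (s + t) := by
        rw [intervalIntegral.integral_comp_add_right, zero_add, add_comm]
      have h3 : ∫ s in (0:ℝ)..τ, f t * f s = f t * ∫ s in (0:ℝ)..τ, f s :=
        (ContinuousLinearMap.mul ℝ A (f t)).intervalIntegral_comp_comm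
          (hfc.intervalIntegrable (μ := MeasureTheory.volume) 0 τ)
      rw [h2, ← h3]
      refine intervalIntegral.integral_congr fun s hs => ?_
      rw [Set.uIcc_of_le hτ.le] at hs
      rw [add_comm, hfadd t s ht hs.1]
    rw [hg]
    simp only
    rw [h1, mul_assoc, hW, V.mul_inv, mul_one]
  have hF : ∀ t, HasDerivAt (fun t => ∫ s in (0:ℝ)..t, f s) (f t) t := fun t =>
    intervalIntegral.integral_hasDerivAt_right (hfc.intervalIntegrable _ _)
      (hfc.stronglyMeasurableAtFilter _ _) hfc.continuousAt
  set K : A := (f τ - 1) * W with hK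
  have hgd : ∀ t, 0 ≤ t → HasDerivAt g (f t * K) t := by
    intro t ht
    have h1 := (((hF (t + τ)).comp_add_const t τ).sub (hF t)).mul_const W
    have h2 : f t * K = (f (t + τ) - f t) * W := by
      rw [hK, hfadd t τ ht hτ.le, ← mul_assoc, mul_sub, mul_one]
    rw [h2]
    exact h1
  have hexp : ∀ t : ℝ, HasDerivAt (fun s : ℝ => NormedSpace.exp ((s : ℂ) • (-K)))
      (-K * NormedSpace.exp ((t : ℂ) • (-K))) t := fun t => by
    simpa [Function.comp_def] using
      (hasDerivAt_exp_smul_const' (-K) (t : ℂ)).scomp t Complex.ofRealCLM.hasDerivAt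
  have hconst : ∀ t : ℝ, 0 ≤ t → g t * NormedSpace.exp ((t : ℂ) • (-K)) = 1 := by
    intro t ht
    have hd : ∀ s : ℝ, 0 ≤ s →
        HasDerivAt (fun s : ℝ => g s * NormedSpace.exp ((s : ℂ) • (-K))) 0 s := by
      intro s hs
      have h1 := (hgd s hs).mul (hexp s)
      have h2 : f s * K * NormedSpace.exp ((s : ℂ) • (-K)) +
          g s * (-K * NormedSpace.exp ((s : ℂ) • (-K))) = 0 := by
        rw [hgf s hs]; noncomm_ring
      rwa [h2] at h1
    have h1 := constant_of_has_deriv_right_zero (a := 0) (b := t)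
      (fun s hs => (hd s hs.1).continuousAt.continuousWithinAt)
      (fun s hs => (hd s hs.1).hasDerivWithinAt) t ⟨ht, le_rfl⟩
    rw [h1, hgf 0 le_rfl, hf0]
    simp
  refine ⟨K, fun t => ?_, fun B hB hαB => ?_⟩
  · have h1 := hconst t t.coe_nonneg
    rw [hgf _ t.coe_nonneg] at h1
    have h2 : f t = α t := by simp [hf]
    have h3 : NormedSpace.exp (((t : ℝ) : ℂ) • (-K)) * NormedSpace.exp (((t : ℝ) : ℂ) • K) = 1 := by
      let _ : NormedAlgebra ℚ A := NormedAlgebra.restrictScalars ℚ ℂ A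
      rw [← NormedSpace.exp_add_of_commute]
      · simp
      · rw [smul_neg]; exact (Commute.refl _).neg_left
    rw [← h2, ← one_mul (NormedSpace.exp _), ← h1, mul_assoc, h3, mul_one]
  · have h1 : HasDerivWithinAt g K (Ioi 0) 0 := by
      simpa [hf0] using (hgd 0 le_rfl).hasDerivWithinAt (s := Ioi 0)
    rw [hasDerivWithinAt_iff_tendsto_slope' self_notMem_Ioi] at h1
    refine hB.mem_of_tendsto h1 ?_
    filter_upwards [self_mem_nhdsWithin] with t ht
    rw [slope_def_module, hgf t (le_of_lt ht), hgf 0 le_rfl]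
    exact B.smul_of_tower_mem _ (B.sub_mem (hαB _) (hαB _))

end Semigroup
end CBS

/-! ### The Hilbert bimodule -/

namespace CBS

section StrongClosure

variable {H : Type*} [NormedAddCommGroup H] [InnerProductSpace ℂ H]

theorem mem_of_mem_strongClosure {s : Set (H →L[ℂ] H)} {P : Set (H → H)} (hP : IsClosed P)
    (hs : ∀ y ∈ s, (y : H → H) ∈ P) {x : H →L[ℂ] H} (hx : x ∈ strongClosure s) :
    (x : H → H) ∈ P :=
  closure_minimal (by rintro _ ⟨y, hy, rfl⟩; exact hs y hy) hP hx

theorem WeakStarContinuous.continuous_inner {T : Type*} [TopologicalSpace T]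
    {f : T → H →L[ℂ] H} (hf : WeakStarContinuous f) (ξ η : H) :
    Continuous fun t => inner ℂ ξ (f t η) := by
  have hs : ∀ ζ : H, Summable fun n => ‖(Pi.single 0 ζ : ℕ → H) n‖ ^ 2 := by
    intro ζ
    refine summable_of_ne_finset_zero (s := {0}) fun n hn => ?_
    rw [Pi.single_eq_of_ne (by simpa using hn)]
    simp
  convert hf (Pi.single 0 ξ) (Pi.single 0 η) (hs ξ) (hs η) using 2 with t
  rw [tsum_eq_single 0]
  · simp
  · intro n hn
    simp [Pi.single_eq_of_ne hn]

theorem norm_sq_eq_norm_star_mul [CompleteSpace H] (x : H →L[ℂ] H) :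
    ‖x‖ ^ 2 = ‖star x * x‖ := by
  rw [CStarRing.norm_star_mul_self, sq]

end StrongClosure

variable {H : Type*} [NormedAddCommGroup H] [InnerProductSpace ℂ H]
  [CompleteSpace H] [TopologicalSpace.SeparableSpace H]

namespace ExpectedSpace

variable (M : ExpectedSpace H)

theorem e₀_eq_gnsProj : M.e₀ = M.gnsProj M.alg₀ := rfl

theorem alg₀_subset : (M.alg₀ : Set (H →L[ℂ] H)) ⊆ M.alg := M.isSubalgebra₀.1

theorem e₀_mul_e₀ : M.e₀ * M.e₀ = M.e₀ := M.gnsProj_mul_self _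

theorem star_e₀ : star M.e₀ = M.e₀ := M.star_gnsProj _

theorem norm_e₀_le : ‖M.e₀‖ ≤ 1 := M.norm_gnsProj_le _

theorem expect_eq (x : H →L[ℂ] H) : M.expect x = M.e₀ * x := by
  rw [expect, inner₀, star_e₀]

theorem commute_e₀ {a : H →L[ℂ] H} (ha : a ∈ M.alg₀) : a * M.e₀ = M.e₀ * a :=
  M.commute_gnsProj ha

theorem e₀_compress (x : M.Elt) :
    M.e₀ * (x : H →L[ℂ] H) * M.e₀ = (M.E₀.toFun x : H →L[ℂ] H) * M.e₀ :=
  M.gnsProj_compress M.alg₀_subset M.E₀ x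

/-- At the corner of `e₀`, the elements of `A₀` commute with the compressed commutant. -/
theorem commute_corner {a y : H →L[ℂ] H} (ha : a ∈ M.alg₀) (hy : y ∈ M.alg₀.commutant) :
    a * M.e₀ * (M.e₀ * y * M.e₀) = M.e₀ * y * M.e₀ * (a * M.e₀) := by
  have h2 : a * y = y * a := VonNeumannAlgebra.mem_commutant_iff.1 hy a ha
  have h4 := M.commute_e₀ ha
  calc a * M.e₀ * (M.e₀ * y * M.e₀) = a * (M.e₀ * M.e₀) * y * M.e₀ := by noncomm_ring
    _ = M.e₀ * (a * y) * M.e₀ := by rw [M.e₀_mul_e₀, h4, mul_assoc M.e₀]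
    _ = M.e₀ * y * (a * M.e₀) := by rw [h2]; noncomm_ring
    _ = M.e₀ * y * (a * (M.e₀ * M.e₀)) := by rw [M.e₀_mul_e₀]
    _ = M.e₀ * y * (M.e₀ * (a * M.e₀)) := by rw [← mul_assoc a, h4, mul_assoc M.e₀ a, h4]
    _ = M.e₀ * y * M.e₀ * (a * M.e₀) := by noncomm_ring

/-- The range of the projection of a larger algebra contains the range of `e₀`. -/
theorem gnsProj_mul_e₀ {B : VonNeumannAlgebra H} (hB : (M.alg₀ : Set (H →L[ℂ] H)) ⊆ B) :
    M.gnsProj B * M.e₀ = M.e₀ := by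
  have := M.mul_gnsProj_ext (B := M.alg₀) (x := M.gnsProj B) (y := 1)
    fun b hb => M.gnsProj_apply (hB hb)
  rwa [one_mul] at this

theorem e₀_mul_gnsProj {B : VonNeumannAlgebra H} (hB : (M.alg₀ : Set (H →L[ℂ] H)) ⊆ B) :
    M.e₀ * M.gnsProj B = M.e₀ := by
  have := congrArg star (M.gnsProj_mul_e₀ hB)
  rwa [star_mul, M.star_e₀, M.star_gnsProj] at this

/-- Independence in operator form: if `C` is independent of `B`, then the compression of `x ∈ C` to
the closure of `B Ω` is `E₀(x)`; that is, the conditional expectation onto `B` restricts to `E₀`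
on `C`. -/
theorem gnsProj_compress_of_independent {B C : VonNeumannAlgebra H}
    (hB : IsSubalgebra M.toProbSpace B) (hBC : M.Independent B C) {x : M.Elt}
    (hx : (x : H →L[ℂ] H) ∈ C) :
    M.gnsProj B * (x : H →L[ℂ] H) * M.gnsProj B =
      (M.E₀.toFun x : H →L[ℂ] H) * M.gnsProj B := by
  obtain ⟨hBA, ⟨E⟩⟩ := hB
  rw [M.gnsProj_compress hBA E x]
  have h0 : ∀ a : M.Elt, (a : H →L[ℂ] H) ∈ M.alg₀ → (a : H →L[ℂ] H) ∈ B := fun a ha =>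
    (hBC.1 ha).1
  suffices h : E.toFun x - M.E₀.toFun x = 0 by rw [sub_eq_zero.1 h]
  set D := E.toFun x - M.E₀.toFun x with hD
  have hDB : (D : H →L[ℂ] H) ∈ B := sub_mem (E.mem x) (h0 _ (M.E₀.mem x))
  have h1 : M.state ((star D * x : M.Elt) : H →L[ℂ] H) =
      M.state ((star D * E.toFun x : M.Elt) : H →L[ℂ] H) := by
    rw [← E.state_eq]
    have := E.bimodule (star D) x 1 (star_mem hDB) (one_mem B)
    rw [mul_one, mul_one] at this
    rw [this]
  have h2 : M.state ((star D * x : M.Elt) : H →L[ℂ] H) =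
      M.state ((star D * M.E₀.toFun x : M.Elt) : H →L[ℂ] H) := by
    rw [← M.E₀.state_eq, ← M.E₀.state_eq (star D * M.E₀.toFun x),
      hBC.2 _ _ (star_mem hDB) hx]
    have := M.E₀.bimodule 1 (star D) (M.E₀.toFun x) (one_mem M.alg₀) (M.E₀.mem x)
    rw [one_mul, one_mul] at this
    rw [this]
  have h3 : inner ℂ ((D : H →L[ℂ] H) M.Ω) ((D : H →L[ℂ] H) M.Ω) = (0:ℂ) := by
    have e1 := M.state_star_mul (D : H →L[ℂ] H) (E.toFun x : H →L[ℂ] H)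
    have e2 := M.state_star_mul (D : H →L[ℂ] H) (M.E₀.toFun x : H →L[ℂ] H)
    have e3 := h1.symm.trans h2
    have e4 : (D : H →L[ℂ] H) M.Ω =
      (E.toFun x : H →L[ℂ] H) M.Ω - (M.E₀.toFun x : H →L[ℂ] H) M.Ω := rfl
    conv_lhs => rw [e4, inner_sub_right]
    rw [← e4, ← e1, ← e2, sub_eq_zero]
    exact e3
  exact Subtype.ext (M.separating _ D.2 (inner_self_eq_zero.1 h3))

/-- The Hilbert bimodule of `B` as a linear subspace. -/
noncomputable def bimodule (B : VonNeumannAlgebra H) : Submodule ℂ (H →L[ℂ] H) :=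
  (((B.toStarSubalgebra.toSubalgebra.toSubmodule.map
    (LinearMap.mulRight ℂ M.e₀)).map
      (LinearMap.ltoFun ℂ H H ℂ ∘ₗ ContinuousLinearMap.coeLM ℂ)).topologicalClosure).comap
      (LinearMap.ltoFun ℂ H H ℂ ∘ₗ ContinuousLinearMap.coeLM ℂ)

theorem mem_bimodule {B : VonNeumannAlgebra H} {x : H →L[ℂ] H} :
    x ∈ M.bimodule B ↔ x ∈ M.bimod B := by
  have h : (((B.toStarSubalgebra.toSubalgebra.toSubmodule.map
      (LinearMap.mulRight ℂ M.e₀)).map (LinearMap.ltoFun ℂ H H ℂ ∘ₗ ContinuousLinearMap.coeLM ℂ)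
        : Submodule ℂ (H → H)) : Set (H → H)) =
      ((fun y : H →L[ℂ] H => (y : H → H)) '' {x | ∃ b ∈ B, x = b * M.e₀}) := by
    ext f
    constructor
    · rintro ⟨_, ⟨b, hb, rfl⟩, rfl⟩
      exact ⟨_, ⟨b, hb, rfl⟩, rfl⟩
    · rintro ⟨_, ⟨b, hb, rfl⟩, rfl⟩
      exact ⟨_, ⟨b, hb, rfl⟩, rfl⟩
  rw [bimod, strongClosure, ← h]
  rfl

variable {M}

theorem bimodule_mono {B C : VonNeumannAlgebra H}
    (h : (B : Set (H →L[ℂ] H)) ⊆ C) : M.bimodule B ≤ M.bimodule C := by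
  intro x hx
  rw [mem_bimodule] at hx ⊢
  refine closure_mono (Set.image_mono ?_) hx
  rintro _ ⟨b, hb, rfl⟩
  exact ⟨b, h hb, rfl⟩

theorem mul_e₀_mem_bimodule {B : VonNeumannAlgebra H} {b : H →L[ℂ] H} (hb : b ∈ B) :
    b * M.e₀ ∈ M.bimodule B := by
  rw [mem_bimodule]
  exact subset_closure ⟨_, ⟨b, hb, rfl⟩, rfl⟩

theorem mem_bimodule_of_tendsto {ι : Type*} {l : Filter ι} [l.NeBot] {B : VonNeumannAlgebra H}
    {x : ι → H →L[ℂ] H}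
    {y : H →L[ℂ] H} (hx : ∀ n, x n ∈ M.bimodule B)
    (h : ∀ ξ, Tendsto (fun n => x n ξ) l (𝓝 (y ξ))) : y ∈ M.bimodule B := by
  rw [mem_bimodule]
  change (y : H → H) ∈ closure _
  refine isClosed_closure.mem_of_tendsto (b := l) (f := fun n => (x n : H → H))
    (tendsto_pi_nhds.2 h) (Eventually.of_forall fun n => ?_)
  exact M.mem_bimodule.1 (hx n)

theorem mul_e₀_of_mem {B : VonNeumannAlgebra H} {x : H →L[ℂ] H} (hx : x ∈ M.bimodule B) :
    x * M.e₀ = x := by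
  rw [mem_bimodule] at hx
  ext ξ
  refine mem_of_mem_strongClosure (P := {f : H → H | f (M.e₀ ξ) = f ξ})
    (isClosed_eq (continuous_apply _) (continuous_apply _)) ?_ hx
  rintro _ ⟨b, _, rfl⟩
  exact congrArg (fun z : H →L[ℂ] H => b (z ξ)) M.e₀_mul_e₀

theorem gnsProj_mul_of_mem {B : VonNeumannAlgebra H} (hB : (M.alg₀ : Set (H →L[ℂ] H)) ⊆ B)
    {x : H →L[ℂ] H} (hx : x ∈ M.bimodule B) : M.gnsProj B * x = x := by
  rw [mem_bimodule] at hx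
  ext ξ
  refine mem_of_mem_strongClosure (P := {f : H → H | M.gnsProj B (f ξ) = f ξ})
    (isClosed_eq ((M.gnsProj B).continuous.comp (continuous_apply ξ)) (continuous_apply _)) ?_ hx
  rintro _ ⟨b, hb, rfl⟩
  have h1 : M.gnsProj B * (b * M.e₀) = b * M.e₀ := by
    rw [← mul_assoc, ← M.commute_gnsProj hb, mul_assoc, M.gnsProj_mul_e₀ hB]
  exact congrArg (fun z : H →L[ℂ] H => z ξ) h1

/-- The expectation of an element of the bimodule belongs to `A₀`. -/
theorem exists_expect_eq {B : VonNeumannAlgebra H} (hB : (B : Set (H →L[ℂ] H)) ⊆ M.alg)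
    {x : H →L[ℂ] H} (hx : x ∈ M.bimodule B) :
    ∃ a ∈ M.alg₀, a * M.e₀ = M.e₀ * x ∧ ‖a‖ ≤ ‖M.e₀ * x‖ := by
  refine M.exists_mul_gnsProj_eq (B := M.alg₀) M.alg₀_subset (T := M.e₀ * x) ?_ ?_ ?_
  · rw [← e₀_eq_gnsProj, ← mul_assoc, M.e₀_mul_e₀]
  · rw [← e₀_eq_gnsProj, mul_assoc, mul_e₀_of_mem hx]
  · intro y hy
    rw [mem_bimodule] at hx
    rw [← e₀_eq_gnsProj]
    ext ξ
    refine mem_of_mem_strongClosure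
      (P := {f : H → H | M.e₀ (f ((M.e₀ * y * M.e₀) ξ)) = (M.e₀ * y * M.e₀) (M.e₀ (f ξ))})
      (isClosed_eq (M.e₀.continuous.comp (continuous_apply _))
        ((M.e₀ * y * M.e₀ * M.e₀).continuous.comp (continuous_apply _))) ?_ hx
    rintro _ ⟨b, hb, rfl⟩
    have h1 := M.e₀_compress ⟨b, hB hb⟩
    simp only at h1
    have h3 : (M.e₀ * b * M.e₀) * (M.e₀ * y * M.e₀) =
        (M.e₀ * y * M.e₀) * (M.e₀ * b * M.e₀) := by
      rw [h1]
      exact M.commute_corner (M.E₀.mem _) hy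
    exact congrArg (fun z : H →L[ℂ] H => z ξ) h3

end ExpectedSpace

end CBS

/-! ### The unitary group of the shift and independence of adjacent intervals -/

namespace CBS

namespace BernoulliShift

variable {H : Type*} [NormedAddCommGroup H] [InnerProductSpace ℂ H]
  [CompleteSpace H] [TopologicalSpace.SeparableSpace H] (M : BernoulliShift H)

theorem ext_gns {x y : H →L[ℂ] H}
    (h : ∀ a : M.Elt, x ((a : H →L[ℂ] H) M.Ω) = y ((a : H →L[ℂ] H) M.Ω)) : x = y := by
  refine ContinuousLinearMap.coeFn_injective (x.continuous.ext_on M.cyclic y.continuous ?_)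
  rintro _ ⟨a, ha, rfl⟩
  exact h ⟨a, ha⟩

theorem U_add (s t : ℝ) : M.U (s + t) = M.U s * M.U t := by
  refine M.ext_gns fun a => ?_
  rw [mul_apply_eq_comp, M.U_apply, M.U_apply, M.U_apply, M.S_add]

theorem S_zero (a : M.Elt) : M.S 0 a = a := by
  refine (M.S 0).injective ?_
  have h := M.S_add 0 0 a
  rw [add_zero] at h
  exact h.symm

theorem U_zero : M.U 0 = 1 := by
  refine M.ext_gns fun a => ?_
  rw [M.U_apply, M.S_zero]
  rfl

theorem star_U_mul_U (t : ℝ) : star (M.U t) * M.U t = 1 := by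
  refine M.ext_gns fun a => ?_
  refine M.cyclic.eq_of_inner_right (𝕜 := ℂ) ?_
  rintro _ ⟨b, hb, rfl⟩
  have h := M.S_state t (star ⟨b, hb⟩ * a)
  rw [map_mul, map_star] at h
  have h1 := M.state_star_mul (M.S t ⟨b, hb⟩ : H →L[ℂ] H) (M.S t a : H →L[ℂ] H)
  have h2 := M.state_star_mul b (a : H →L[ℂ] H)
  rw [mul_apply_eq_comp, ContinuousLinearMap.star_eq_adjoint,
    ContinuousLinearMap.adjoint_inner_right, M.U_apply, M.U_apply t ⟨b, hb⟩, ← h1]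
  exact h.trans h2

theorem norm_U_apply (t : ℝ) (ξ : H) : ‖M.U t ξ‖ = ‖ξ‖ := by
  have h := congrArg (fun x : H →L[ℂ] H => RCLike.re (inner ℂ ξ (x ξ))) (M.star_U_mul_U t)
  simp only [mul_apply_eq_comp, one_apply_eq_self, ContinuousLinearMap.star_eq_adjoint,
    ContinuousLinearMap.adjoint_inner_right, inner_self_eq_norm_sq] at h
  exact (sq_eq_sq₀ (norm_nonneg _) (norm_nonneg _)).1 h

theorem norm_U_mul (t : ℝ) (x : H →L[ℂ] H) : ‖M.U t * x‖ = ‖x‖ := by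
  refine (sq_eq_sq₀ (norm_nonneg _) (norm_nonneg _)).1 ?_
  rw [norm_sq_eq_norm_star_mul, norm_sq_eq_norm_star_mul, star_mul, mul_assoc,
    ← mul_assoc (star (M.U t)), M.star_U_mul_U, one_mul]

theorem U_mul_e₀ (t : ℝ) : M.U t * M.e₀ = M.e₀ := by
  have := M.mul_gnsProj_ext (B := M.alg₀) (x := M.U t) (y := 1) fun b hb => by
    have h1 := M.U_apply t ⟨b, M.alg₀_subset hb⟩
    rw [(M.fixed ⟨b, M.alg₀_subset hb⟩).1 hb t] at h1
    exact h1
  rwa [one_mul] at this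

theorem e₀_mul_U (t : ℝ) : M.e₀ * M.U t = M.e₀ := by
  have h : star (M.U t) * M.e₀ = M.e₀ := by
    conv_lhs => rw [← M.U_mul_e₀ t]
    rw [← mul_assoc, M.star_U_mul_U, one_mul]
  have := congrArg star h
  rwa [star_mul, star_star, M.star_e₀] at this

/-- The unitary group is strongly continuous, because it is weakly continuous on `A Ω` and
isometric. -/
theorem continuous_U_apply (ξ : H) : Continuous fun t => M.U t ξ := by
  have hA : ∀ a : M.Elt, Continuous fun t => M.U t ((a : H →L[ℂ] H) M.Ω) := by
    intro a
    rw [continuous_iff_continuousAt]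
    intro s
    rw [ContinuousAt, tendsto_iff_norm_sub_tendsto_zero]
    have h1 : Continuous fun t => inner ℂ (M.U s ((a : H →L[ℂ] H) M.Ω))
        (M.U t ((a : H →L[ℂ] H) M.Ω)) := by
      simp only [M.U_apply]
      exact (M.S_continuous a).continuous_inner _ _
    have h2 : ∀ t, ‖M.U t ((a : H →L[ℂ] H) M.Ω) - M.U s ((a : H →L[ℂ] H) M.Ω)‖ =
        Real.sqrt (2 * ‖(a : H →L[ℂ] H) M.Ω‖ ^ 2 - 2 * RCLike.re
          (inner ℂ (M.U s ((a : H →L[ℂ] H) M.Ω)) (M.U t ((a : H →L[ℂ] H) M.Ω)))) := by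
      intro t
      rw [norm_sub_rev, ← Real.sqrt_sq (norm_nonneg (_ - _)), norm_sub_sq (𝕜 := ℂ),
        M.norm_U_apply, M.norm_U_apply]
      congr 1
      ring
    simp only [h2]
    have h3 : Continuous fun t => Real.sqrt (2 * ‖(a : H →L[ℂ] H) M.Ω‖ ^ 2 - 2 * RCLike.re
        (inner ℂ (M.U s ((a : H →L[ℂ] H) M.Ω)) (M.U t ((a : H →L[ℂ] H) M.Ω)))) :=
      (continuous_const.sub (continuous_const.mul (RCLike.continuous_re.comp h1))).sqrt
    convert h3.tendsto s using 2
    rw [inner_self_eq_norm_sq, M.norm_U_apply, sub_self, Real.sqrt_zero]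
  refine continuous_of_uniform_approx_of_continuous fun V hV => ?_
  obtain ⟨ε, hε, hεV⟩ := Metric.mem_uniformity_dist.1 hV
  obtain ⟨_, ⟨a, ha, rfl⟩, hη⟩ := M.cyclic.exists_dist_lt ξ hε
  refine ⟨_, hA ⟨a, ha⟩, fun t => hεV ?_⟩
  rw [dist_eq_norm, ← map_sub, M.norm_U_apply, ← dist_eq_norm]
  exact hη

theorem alg₀_subset_F {I : Set ℝ} (hI : I.OrdConnected) :
    (M.alg₀ : Set (H →L[ℂ] H)) ⊆ M.F I := fun _ hx =>
  ((M.independent I ∅ hI Set.ordConnected_empty (Set.inter_empty I)).1 hx).1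

theorem F_subset (I : Set ℝ) (hI : I.OrdConnected) : (M.F I : Set (H →L[ℂ] H)) ⊆ M.alg :=
  (M.F_subalgebra I hI).1

theorem E₀_S (t : ℝ) (x : M.Elt) :
    (M.E₀.toFun (M.S t x) : H →L[ℂ] H) = M.E₀.toFun x := by
  refine M.eq_of_mul_gnsProj_eq M.alg₀_subset (M.E₀.mem _) (M.E₀.mem _) ?_
  have h1 := M.e₀_compress (M.S t x)
  have h2 := M.e₀_compress x
  rw [mul_assoc, ← M.shift_apply, shift, ← mul_assoc, M.e₀_mul_U, ← mul_assoc, h2] at h1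
  exact h1.symm

/-- Independence of adjacent closed intervals: the algebra of `[s, t]` is moved off `[r, s]` by a
small positive shift, and the shift is weakly continuous. -/
theorem past_compress {r s t : ℝ} {x : M.Elt} (hx : (x : H →L[ℂ] H) ∈ M.F (Icc s t)) :
    M.gnsProj (M.F (Icc r s)) * (x : H →L[ℂ] H) * M.gnsProj (M.F (Icc r s)) =
      (M.E₀.toFun x : H →L[ℂ] H) * M.gnsProj (M.F (Icc r s)) := by
  set e := M.gnsProj (M.F (Icc r s)) with he
  have h1 : ∀ ε : ℝ, 0 < ε → e * (M.S ε x : H →L[ℂ] H) * e =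
      (M.E₀.toFun x : H →L[ℂ] H) * e := by
    intro ε hε
    have h2 : (M.S ε x : H →L[ℂ] H) ∈ M.F ((fun y => y + ε) '' Icc s t) := by
      rw [← SetLike.mem_coe, ← M.covariant ε _ Set.ordConnected_Icc]
      exact ⟨x, hx, rfl⟩
    rw [Set.image_add_const_Icc] at h2
    rw [M.gnsProj_compress_of_independent (M.F_subalgebra _ Set.ordConnected_Icc)
      (M.independent _ _ Set.ordConnected_Icc Set.ordConnected_Icc ?_) h2, M.E₀_S]
    ext y
    simp only [mem_inter_iff, mem_Icc, mem_empty_iff_false, iff_false]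
    rintro ⟨h3, h4⟩
    linarith [h3.2, h4.1]
  ext η
  refine ext_inner_left ℂ fun ξ => ?_
  have h2 : Tendsto (fun ε : ℝ => inner ℂ (e ξ) ((M.S ε x : H →L[ℂ] H) (e η))) (𝓝[>] 0)
      (𝓝 (inner ℂ (e ξ) ((M.S 0 x : H →L[ℂ] H) (e η)))) :=
    (((M.S_continuous x).continuous_inner (e ξ) (e η)).tendsto 0).mono_left nhdsWithin_le_nhds
  have h3 : ∀ y : H →L[ℂ] H, inner ℂ ξ ((e * y * e) η) = inner ℂ (e ξ) (y (e η)) := by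
    intro y
    conv_lhs => rw [he, ← M.star_gnsProj, ← he]
    rw [mul_apply_eq_comp, mul_apply_eq_comp, ContinuousLinearMap.star_eq_adjoint,
      ContinuousLinearMap.adjoint_inner_right, ← ContinuousLinearMap.star_eq_adjoint, he,
      M.star_gnsProj]
  rw [M.S_zero, ← h3] at h2
  refine tendsto_nhds_unique h2 (tendsto_const_nhds.congr' ?_)
  filter_upwards [self_mem_nhdsWithin] with ε hε
  rw [← h3, h1 ε hε]

/-- An element of the bimodule of the future `[s, t]` is seen from the past `[r, s]` through its
expectation only. -/
theorem past_mul {r s t : ℝ} {w : H →L[ℂ] H} (hw : w ∈ M.bimodule (M.F (Icc s t))) :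
    M.gnsProj (M.F (Icc r s)) * w = M.e₀ * w := by
  rw [ExpectedSpace.mem_bimodule] at hw
  ext ξ
  refine mem_of_mem_strongClosure
    (P := {f : H → H | M.gnsProj (M.F (Icc r s)) (f ξ) = M.e₀ (f ξ)})
    (isClosed_eq ((ContinuousLinearMap.continuous _).comp (continuous_apply ξ))
      ((ContinuousLinearMap.continuous _).comp (continuous_apply ξ))) ?_ hw
  rintro _ ⟨b, hb, rfl⟩
  have hbA := M.F_subset _ Set.ordConnected_Icc hb
  have h1 := M.past_compress (r := r) (x := ⟨b, hbA⟩) hb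
  have h2 := M.e₀_compress ⟨b, hbA⟩
  have h0 := M.gnsProj_mul_e₀ (M.alg₀_subset_F (I := Icc r s) Set.ordConnected_Icc)
  simp only at h1 h2
  have h3 : M.gnsProj (M.F (Icc r s)) * (b * M.e₀) = M.e₀ * (b * M.e₀) := by
    conv_lhs => rw [← h0]
    rw [← mul_assoc, ← mul_assoc, h1, mul_assoc, h0, ← h2, mul_assoc]
  exact congrArg (fun z : H →L[ℂ] H => z ξ) h3

theorem U_mul_mem {r s : ℝ} (t : ℝ) {x : H →L[ℂ] H} (hx : x ∈ M.bimodule (M.F (Icc r s))) :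
    M.U t * x ∈ M.bimodule (M.F (Icc (r + t) (s + t))) := by
  rw [ExpectedSpace.mem_bimodule] at hx ⊢
  refine mem_of_mem_strongClosure
    (P := (fun f : H → H => fun ξ => M.U t (f ξ)) ⁻¹' closure ((fun y : H →L[ℂ] H => (y : H → H)) ''
      {x | ∃ b ∈ M.F (Icc (r + t) (s + t)), x = b * M.e₀})) ?_ ?_ hx
  · refine isClosed_closure.preimage (continuous_pi fun ξ => ?_)
    exact (M.U t).continuous.comp (continuous_apply ξ)
  · rintro _ ⟨b, hb, rfl⟩
    have hbA := M.F_subset _ Set.ordConnected_Icc hb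
    refine subset_closure ⟨(M.S t ⟨b, hbA⟩ : H →L[ℂ] H) * M.e₀, ⟨_, ?_, rfl⟩, ?_⟩
    · rw [← SetLike.mem_coe, ← Set.image_add_const_Icc,
        ← M.covariant t _ Set.ordConnected_Icc]
      exact ⟨⟨b, hbA⟩, hb, rfl⟩
    · rw [← M.shift_apply]
      rfl

end BernoulliShift

end CBS

/-! ### Products of independent elements -/

namespace CBS

namespace ExpectedSpace

variable {H : Type*} [NormedAddCommGroup H] [InnerProductSpace ℂ H]
  [CompleteSpace H] [TopologicalSpace.SeparableSpace H] (M : ExpectedSpace H)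

theorem norm_le_norm_mul_e₀ {a : H →L[ℂ] H} (ha : a ∈ M.alg₀) : ‖a‖ ≤ ‖a * M.e₀‖ := by
  obtain ⟨b, hb, h1, h2⟩ := M.exists_mul_gnsProj_eq (B := M.alg₀) M.alg₀_subset
    (T := a * M.e₀)
    (by rw [← e₀_eq_gnsProj, ← mul_assoc, ← M.commute_e₀ ha, mul_assoc, M.e₀_mul_e₀])
    (by rw [← e₀_eq_gnsProj, mul_assoc, M.e₀_mul_e₀])
    (fun x hx => M.commute_corner ha hx)
  have h3 := M.eq_of_mul_gnsProj_eq M.alg₀_subset hb ha h1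
  rwa [h3] at h2

/-- Strong convergence in `A₀` can be tested on the range of `e₀`: convergence propagates to the
dense subspace `A₀' Ω`, and the norms are bounded. -/
theorem tendsto_apply_of_tendsto_e₀ {b : ℕ → H →L[ℂ] H} {β : H →L[ℂ] H} (hb : ∀ n, b n ∈ M.alg₀)
    (hβ : β ∈ M.alg₀) (h : ∀ ξ, Tendsto (fun n => (b n * M.e₀) ξ) atTop (𝓝 ((β * M.e₀) ξ)))
    (ξ : H) : Tendsto (fun n => b n ξ) atTop (𝓝 (β ξ)) := by
  obtain ⟨C, hC⟩ := banach_steinhaus (g := fun n => b n * M.e₀) fun ξ => by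
    obtain ⟨C, hC⟩ := (h ξ).norm.bddAbove_range
    exact ⟨C, fun i => hC ⟨i, rfl⟩⟩
  have hC' : ∀ n, ‖b n‖ ≤ C := fun n => (M.norm_le_norm_mul_e₀ (hb n)).trans (hC n)
  have hdense : ∀ x ∈ M.alg₀.commutant,
      Tendsto (fun n => b n (x M.Ω)) atTop (𝓝 (β (x M.Ω))) := by
    intro x hx
    have h1 : ∀ a ∈ M.alg₀, a (x M.Ω) = x ((a * M.e₀) M.Ω) := by
      intro a ha
      have h2 : a * x = x * a := VonNeumannAlgebra.mem_commutant_iff.1 hx a ha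
      have h3 : M.e₀ M.Ω = M.Ω := M.gnsProj_Ω
      rw [mul_apply_eq_comp, h3]
      exact congrArg (fun z : H →L[ℂ] H => z M.Ω) h2
    rw [h1 β hβ]
    simp only [h1 _ (hb _)]
    exact (x.continuous.tendsto _).comp (h M.Ω)
  have hequi : Equicontinuous fun n => (b n : H → H) :=
    (LipschitzWith.uniformEquicontinuous _ C.toNNReal fun n =>
      (b n).lipschitz.weaken (NNReal.le_toNNReal_of_coe_le (hC' n))).equicontinuous
  have hcl := hequi.isClosed_setOfPred_tendsto (l := atTop) β.continuous
  refine closure_minimal ?_ hcl (M.dense_commutant M.alg₀_subset ξ)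
  rintro _ ⟨x, hx, rfl⟩
  exact hdense x hx

theorem IsProduct.left_mem {B : VonNeumannAlgebra H} {x y z : H →L[ℂ] H}
    (h : M.IsProduct B x y z) : x ∈ M.bimodule B := by
  obtain ⟨a, ha, h1, -⟩ := h
  exact mem_bimodule_of_tendsto (fun n => mul_e₀_mem_bimodule (ha n)) h1

variable {M}

/-- `E₀(xy) = E₀(x) E₀(y)` for the product of independent elements. -/
theorem IsProduct.e₀_mul {B C : VonNeumannAlgebra H}
    (hC : (C : Set (H →L[ℂ] H)) ⊆ M.alg) {x y z : H →L[ℂ] H}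
    (hind : ∀ a : M.Elt, (a : H →L[ℂ] H) ∈ C → M.gnsProj B * (a : H →L[ℂ] H) * M.gnsProj B =
      (M.E₀.toFun a : H →L[ℂ] H) * M.gnsProj B)
    (hy : M.gnsProj B * y = y) (h0 : M.e₀ * M.gnsProj B = M.e₀)
    (h : M.IsProduct C x y z) : M.e₀ * z = M.e₀ * x * y := by
  obtain ⟨a, ha, h1, h2⟩ := h
  have h3 : ∀ n, M.e₀ * (a n * y) = M.e₀ * (a n * M.e₀) * y := by
    intro n
    have h4 := hind ⟨a n, hC (ha n)⟩ (ha n)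
    have h5 := M.e₀_compress ⟨a n, hC (ha n)⟩
    simp only at h4 h5
    calc M.e₀ * (a n * y) = M.e₀ * M.gnsProj B * (a n * (M.gnsProj B * y)) := by rw [h0, hy]
      _ = M.e₀ * (M.gnsProj B * a n * M.gnsProj B) * y := by noncomm_ring
      _ = M.e₀ * (M.E₀.toFun ⟨a n, hC (ha n)⟩ : H →L[ℂ] H) * (M.gnsProj B * y) := by
        rw [h4]; noncomm_ring
      _ = M.e₀ * (a n * M.e₀) * y := by
        rw [hy, ← M.commute_e₀ (M.E₀.mem _), ← h5, mul_assoc M.e₀]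
  ext ξ
  refine tendsto_nhds_unique ((M.e₀.continuous.tendsto _).comp (h2 ξ)) ?_
  refine ((M.e₀.continuous.tendsto _).comp (h1 (y ξ))).congr fun n => ?_
  exact (congrArg (fun u : H →L[ℂ] H => u ξ) (h3 n)).symm

/-- The left factor may be centred: `(x - E₀ x) y = xy - (E₀ x) y`. -/
theorem IsProduct.sub_expect {C : VonNeumannAlgebra H}
    (hC : (C : Set (H →L[ℂ] H)) ⊆ M.alg) (hC0 : (M.alg₀ : Set (H →L[ℂ] H)) ⊆ C)
    {x y z α : H →L[ℂ] H} (hα : α ∈ M.alg₀) (hαx : α * M.e₀ = M.e₀ * x)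
    (h : M.IsProduct C x y z) : M.IsProduct C (x - α * M.e₀) y (z - α * y) := by
  obtain ⟨a, ha, h1, h2⟩ := h
  set b : ℕ → H →L[ℂ] H := fun n => (M.E₀.toFun ⟨a n, hC (ha n)⟩ : H →L[ℂ] H) with hb
  have hb0 : ∀ n, b n ∈ M.alg₀ := fun n => M.E₀.mem _
  have hbe : ∀ ξ, Tendsto (fun n => (b n * M.e₀) ξ) atTop (𝓝 ((α * M.e₀) ξ)) := by
    intro ξ
    rw [hαx]
    refine ((M.e₀.continuous.tendsto _).comp (h1 ξ)).congr fun n => ?_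
    have h5 := M.e₀_compress ⟨a n, hC (ha n)⟩
    rw [mul_assoc] at h5
    exact congrArg (fun u : H →L[ℂ] H => u ξ) h5
  have hbt := M.tendsto_apply_of_tendsto_e₀ hb0 hα hbe
  refine ⟨fun n => a n - b n, fun n => sub_mem (ha n) (hC0 (hb0 n)), fun ξ => ?_, fun ξ => ?_⟩
  · exact ((h1 ξ).sub (hbe ξ)).congr fun n => by simp [sub_mul]
  · exact ((h2 ξ).sub (hbt (y ξ))).congr fun n => by simp [sub_mul]

theorem IsProduct.sub_right {C : VonNeumannAlgebra H} {x y z : H →L[ℂ] H}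
    (h : M.IsProduct C x y z) : M.IsProduct C x (y - M.e₀ * y) (z - x * y) := by
  obtain ⟨a, ha, h1, h2⟩ := h
  refine ⟨a, ha, h1, fun ξ => ?_⟩
  exact ((h2 ξ).sub (h1 (y ξ))).congr fun n => by simp [mul_sub]

/-- The norm of a product of independent elements is submultiplicative. If `aₙ e₀ → x`, then
`‖aₙ η‖² = ⟨η, E₀(aₙ^* aₙ) η⟩` on the range of the projection of `B`. The operators `E₀(aₙ^* aₙ)` are
bounded, and on the dense subspace `A₀' Ω` their quadratic forms converge to that of the element
of `A₀` which represents `x^* x`. -/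
theorem IsProduct.norm_le {B C : VonNeumannAlgebra H}
    (hC : (C : Set (H →L[ℂ] H)) ⊆ M.alg) {x y z : H →L[ℂ] H}
    (hind : ∀ a : M.Elt, (a : H →L[ℂ] H) ∈ C → M.gnsProj B * (a : H →L[ℂ] H) * M.gnsProj B =
      (M.E₀.toFun a : H →L[ℂ] H) * M.gnsProj B)
    (hy : M.gnsProj B * y = y)
    (h : M.IsProduct C x y z) : ‖z‖ ≤ ‖x‖ * ‖y‖ := by
  have hxe : x * M.e₀ = x := mul_e₀_of_mem h.left_mem
  obtain ⟨a, ha, h1, h2⟩ := h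
  have hΩ : M.e₀ M.Ω = M.Ω := M.gnsProj_Ω
  have hsq : ∀ (w : H →L[ℂ] H) (ξ η : H), inner ℂ ξ ((star w * w) η) = inner ℂ (w ξ) (w η) := by
    intro w ξ η
    rw [mul_apply_eq_comp, ContinuousLinearMap.star_eq_adjoint,
      ContinuousLinearMap.adjoint_inner_right]
  let c : ℕ → M.Elt := fun n => star ⟨a n, hC (ha n)⟩ * ⟨a n, hC (ha n)⟩
  have hc : ∀ n, (c n : H →L[ℂ] H) = star (a n) * a n := fun n => rfl
  set γ : ℕ → H →L[ℂ] H := fun n => (M.E₀.toFun (c n) : H →L[ℂ] H) with hγ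
  have hγ0 : ∀ n, γ n ∈ M.alg₀ := fun n => M.E₀.mem _
  have hγpos : ∀ n, 0 ≤ γ n := fun n =>
    (ContinuousLinearMap.nonneg_iff_isPositive _).2 (M.E₀.positive ⟨a n, hC (ha n)⟩)
  have hγe : ∀ n, γ n * M.e₀ = star (a n * M.e₀) * (a n * M.e₀) := by
    intro n
    rw [hγ]
    simp only
    rw [← M.e₀_compress, hc, star_mul, M.star_e₀]
    noncomm_ring
  obtain ⟨D, hD⟩ := banach_steinhaus (g := fun n => a n * M.e₀) fun ξ => by
    obtain ⟨D, hD⟩ := (h1 ξ).norm.bddAbove_range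
    exact ⟨D, fun i => hD ⟨i, rfl⟩⟩
  have hγD : ∀ n, ‖γ n‖ ≤ D ^ 2 := by
    intro n
    refine (M.norm_le_norm_mul_e₀ (hγ0 n)).trans ?_
    rw [hγe, ← norm_sq_eq_norm_star_mul]
    gcongr
    exact hD n
  have hD0 : 0 ≤ D := (norm_nonneg _).trans (hD 0)
  -- the element of `A₀` which represents `x^* x`
  obtain ⟨g, hg, hge, hgn⟩ := M.exists_mul_gnsProj_eq (B := M.alg₀) M.alg₀_subset
    (T := star x * x) (by
      have e1 := congrArg star hxe
      rw [star_mul, M.star_e₀] at e1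
      rw [← e₀_eq_gnsProj, ← mul_assoc, e1])
    (by rw [← e₀_eq_gnsProj, mul_assoc, hxe]) (by
      intro v hv
      rw [← e₀_eq_gnsProj]
      set k := M.e₀ * v * M.e₀ with hk
      ext η
      refine ext_inner_left ℂ fun ξ => ?_
      have e1 : ∀ n, inner ℂ ((a n * M.e₀) ξ) ((a n * M.e₀) (k η)) =
          inner ℂ ((a n * M.e₀) (star k ξ)) ((a n * M.e₀) η) := by
        intro n
        have e2 := M.commute_corner (hγ0 n) hv
        rw [hγe, ← hk] at e2
        rw [← hsq, ← hsq]
        have e3 := congrArg (fun u : H →L[ℂ] H => inner ℂ ξ (u η)) e2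
        rw [ContinuousLinearMap.star_eq_adjoint k, ContinuousLinearMap.adjoint_inner_left]
        exact e3
      have e4 := (h1 ξ).inner (𝕜 := ℂ) (h1 (k η))
      have e5 := (h1 (star k ξ)).inner (𝕜 := ℂ) (h1 η)
      simp only [e1] at e4
      have e6 := tendsto_nhds_unique e4 e5
      rw [← hsq, ← hsq, ContinuousLinearMap.star_eq_adjoint k,
        ContinuousLinearMap.adjoint_inner_left] at e6
      exact e6)
  rw [← e₀_eq_gnsProj] at hge
  rw [← norm_sq_eq_norm_star_mul] at hgn
  have hks : ∀ n, ∀ η, ‖CFC.sqrt (γ n) η‖ ^ 2 = RCLike.re (inner ℂ η (γ n η)) := by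
    intro n η
    have e1 : star (CFC.sqrt (γ n)) * CFC.sqrt (γ n) = γ n := by
      rw [(CFC.sqrt_nonneg (γ n)).isSelfAdjoint.star_eq]
      exact CFC.sqrt_mul_sqrt_self _ (hγpos n)
    conv_rhs => rw [← e1, hsq, inner_self_eq_norm_sq]
  have hkn : ∀ n, ‖CFC.sqrt (γ n)‖ ≤ D := by
    intro n
    refine abs_le_of_sq_le_sq' ?_ hD0 |>.2
    have e1 : star (CFC.sqrt (γ n)) * CFC.sqrt (γ n) = γ n := by
      rw [(CFC.sqrt_nonneg (γ n)).isSelfAdjoint.star_eq]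
      exact CFC.sqrt_mul_sqrt_self _ (hγpos n)
    rw [norm_sq_eq_norm_star_mul, e1]
    exact hγD n
  -- convergence of the quadratic forms on `A₀' Ω`
  have hdense : ∀ v ∈ M.alg₀.commutant, Tendsto (fun n => ‖CFC.sqrt (γ n) (v M.Ω)‖ ^ 2) atTop
      (𝓝 (RCLike.re (inner ℂ (v M.Ω) (g (v M.Ω))))) := by
    intro v hv
    have e1 : ∀ b ∈ M.alg₀, inner ℂ (v M.Ω) (b (v M.Ω)) =
        inner ℂ ((star v * v) M.Ω) ((b * M.e₀) M.Ω) := by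
      intro b hb
      have e2 : b * v = v * b := VonNeumannAlgebra.mem_commutant_iff.1 hv b hb
      have e3 : b (v M.Ω) = v (b M.Ω) := congrArg (fun u : H →L[ℂ] H => u M.Ω) e2
      rw [e3, mul_apply_eq_comp b, hΩ, mul_apply_eq_comp, ContinuousLinearMap.star_eq_adjoint,
        ContinuousLinearMap.adjoint_inner_left]
    simp only [hks, e1 _ (hγ0 _), e1 g hg, hγe, hge, hsq]
    exact (RCLike.continuous_re.tendsto _).comp ((h1 _).inner (h1 _))
  have hbound : ∀ v ∈ M.alg₀.commutant, ∀ ξ,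
      ‖z ξ‖ ≤ ‖x‖ * ‖v M.Ω‖ + D * ‖y ξ - v M.Ω‖ := by
    intro v hv ξ
    have e1 : ∀ n, ‖(a n * y) ξ‖ = ‖CFC.sqrt (γ n) (y ξ)‖ := by
      intro n
      refine (sq_eq_sq₀ (norm_nonneg _) (norm_nonneg _)).1 ?_
      rw [hks, ← inner_self_eq_norm_sq (𝕜 := ℂ)]
      congr 1
      have e2 := hind (c n) (mul_mem (star_mem (ha n)) (ha n))
      have e3 : star y * (star (a n) * a n) * y = star y * γ n * y := by
        calc star y * (star (a n) * a n) * y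
            = star y * M.gnsProj B * (star (a n) * a n) * (M.gnsProj B * y) := by
              conv_lhs => rw [← hy, star_mul, M.star_gnsProj]
          _ = star y * (M.gnsProj B * (star (a n) * a n) * M.gnsProj B) * y := by noncomm_ring
          _ = star y * γ n * (M.gnsProj B * y) := by rw [← hc, e2]; noncomm_ring
          _ = star y * γ n * y := by rw [hy]
      have e4 := congrArg (fun u : H →L[ℂ] H => inner ℂ ξ (u ξ)) e3
      simp only [mul_apply_eq_comp, ContinuousLinearMap.star_eq_adjoint,
        ContinuousLinearMap.adjoint_inner_right] at e4
      exact e4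
    have e2 : ∀ n, ‖(a n * y) ξ‖ - D * ‖y ξ - v M.Ω‖ ≤ ‖CFC.sqrt (γ n) (v M.Ω)‖ := by
      intro n
      have e3 : CFC.sqrt (γ n) (y ξ) =
          CFC.sqrt (γ n) (v M.Ω) + CFC.sqrt (γ n) (y ξ - v M.Ω) := by
        rw [← map_add, add_sub_cancel]
      rw [e1, e3]
      have e4 := (CFC.sqrt (γ n)).le_of_opNorm_le (hkn n) (y ξ - v M.Ω)
      have e5 := norm_add_le (CFC.sqrt (γ n) (v M.Ω)) (CFC.sqrt (γ n) (y ξ - v M.Ω))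
      linarith
    have e3 : Tendsto (fun n => ‖CFC.sqrt (γ n) (v M.Ω)‖) atTop
        (𝓝 (Real.sqrt (RCLike.re (inner ℂ (v M.Ω) (g (v M.Ω)))))) :=
      (hdense v hv).sqrt.congr fun n => Real.sqrt_sq (norm_nonneg _)
    have e4 := le_of_tendsto_of_tendsto' ((h2 ξ).norm.sub_const _) e3 e2
    have e5 : Real.sqrt (RCLike.re (inner ℂ (v M.Ω) (g (v M.Ω)))) ≤ ‖x‖ * ‖v M.Ω‖ := by
      refine Real.sqrt_le_iff.2 ⟨by positivity, ?_⟩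
      calc RCLike.re (inner ℂ (v M.Ω) (g (v M.Ω))) ≤ ‖v M.Ω‖ * ‖g (v M.Ω)‖ :=
            re_inner_le_norm _ _
        _ ≤ ‖v M.Ω‖ * (‖x‖ ^ 2 * ‖v M.Ω‖) := by
            gcongr
            exact g.le_of_opNorm_le hgn _
        _ = (‖x‖ * ‖v M.Ω‖) ^ 2 := by ring
    linarith
  refine ContinuousLinearMap.opNorm_le_bound _ (by positivity) fun ξ => ?_
  have hcl : ∀ η : H, ‖z ξ‖ ≤ ‖x‖ * ‖η‖ + D * ‖y ξ - η‖ := by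
    intro η
    refine closure_minimal (t := {η : H | ‖z ξ‖ ≤ ‖x‖ * ‖η‖ + D * ‖y ξ - η‖}) ?_ ?_
      (M.dense_commutant M.alg₀_subset η)
    · rintro _ ⟨v, hv, rfl⟩
      exact hbound v hv ξ
    · exact isClosed_le (by fun_prop) (by fun_prop)
  refine (hcl (y ξ)).trans ?_
  rw [sub_self, norm_zero, mul_zero, add_zero, mul_assoc]
  gcongr
  exact y.le_opNorm ξ

end ExpectedSpace

end CBS

/-! ### Centred increments and additive families -/

namespace CBS

namespace BernoulliShift

variable {H : Type*} [NormedAddCommGroup H] [InnerProductSpace ℂ H]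
  [CompleteSpace H] [TopologicalSpace.SeparableSpace H] (M : BernoulliShift H)

theorem shift_add (t : ℝ) (x y : H →L[ℂ] H) : M.shift t (x + y) = M.shift t x + M.shift t y :=
  mul_add _ _ _

theorem shift_sub (t : ℝ) (x y : H →L[ℂ] H) : M.shift t (x - y) = M.shift t x - M.shift t y :=
  mul_sub _ _ _

theorem shift_zero_right (t : ℝ) : M.shift t 0 = 0 := mul_zero _

theorem shift_zero (x : H →L[ℂ] H) : M.shift 0 x = x := by rw [shift, U_zero, one_mul]

theorem shift_shift (s t : ℝ) (x : H →L[ℂ] H) : M.shift s (M.shift t x) = M.shift (s + t) x := by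
  rw [shift, shift, shift, U_add, mul_assoc]

theorem norm_shift (t : ℝ) (x : H →L[ℂ] H) : ‖M.shift t x‖ = ‖x‖ := M.norm_U_mul t x

theorem continuous_shift_apply {T : Type*} [TopologicalSpace T] {f : T → ℝ} {x : T → H →L[ℂ] H}
    (hf : Continuous f) (hx : ∀ ξ, Continuous fun t => x t ξ) (ξ : H) :
    Continuous fun t => M.shift (f t) (x t) ξ := by
  rw [continuous_iff_continuousAt]
  intro t
  rw [ContinuousAt, tendsto_iff_norm_sub_tendsto_zero]
  have h1 : Tendsto (fun s => ‖x s ξ - x t ξ‖ + ‖M.U (f s) (x t ξ) - M.U (f t) (x t ξ)‖) (𝓝 t)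
      (𝓝 0) := by
    have h2 := tendsto_iff_norm_sub_tendsto_zero.1 ((hx ξ).tendsto t)
    have h3 := tendsto_iff_norm_sub_tendsto_zero.1
      (((M.continuous_U_apply (x t ξ)).comp hf).tendsto t)
    simpa using h2.add h3
  refine squeeze_zero (fun _ => norm_nonneg _) (fun s => ?_) h1
  have h2 : M.shift (f s) (x s) ξ - M.shift (f t) (x t) ξ =
      M.U (f s) (x s ξ - x t ξ) + (M.U (f s) (x t ξ) - M.U (f t) (x t ξ)) := by
    rw [map_sub]
    change M.U (f s) (x s ξ) - M.U (f t) (x t ξ) = _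
    abel
  rw [h2]
  refine (norm_add_le _ _).trans ?_
  rw [M.norm_U_apply]

/-- The centred part of the Hilbert bimodule of `[0, t]`. -/
noncomputable def centred (t : ℝ≥0) : Submodule ℂ (H →L[ℂ] H) :=
  M.bimodule (M.F (Icc 0 (t : ℝ))) ⊓ (LinearMap.mulLeft ℂ M.e₀).ker

variable {M}

theorem mem_centred {t : ℝ≥0} {x : H →L[ℂ] H} :
    x ∈ M.centred t ↔ x ∈ M.bimodule (M.F (Icc 0 (t : ℝ))) ∧ M.e₀ * x = 0 := by
  rw [centred, Submodule.mem_inf, LinearMap.mem_ker, LinearMap.mulLeft_apply]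

theorem bimodule_Icc_mono {r s r' s' : ℝ} (hr : r' ≤ r) (hs : s ≤ s') :
    M.bimodule (M.F (Icc r s)) ≤ M.bimodule (M.F (Icc r' s')) :=
  ExpectedSpace.bimodule_mono
    (M.F_mono _ _ Set.ordConnected_Icc Set.ordConnected_Icc (Icc_subset_Icc hr hs))

theorem e₀_mul_shift (t : ℝ) (x : H →L[ℂ] H) : M.e₀ * M.shift t x = M.e₀ * x := by
  rw [shift, ← mul_assoc, M.e₀_mul_U]

theorem shift_mem_bimodule (s : ℝ≥0) {t : ℝ≥0} {x : H →L[ℂ] H}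
    (hx : x ∈ M.bimodule (M.F (Icc 0 (t : ℝ)))) :
    M.shift s x ∈ M.bimodule (M.F (Icc (s : ℝ) ((s : ℝ) + t))) := by
  have := M.U_mul_mem (s : ℝ) hx
  rwa [zero_add, add_comm (t : ℝ)] at this

theorem add_shift_mem_bimodule {s t : ℝ≥0} {x y : H →L[ℂ] H}
    (hx : x ∈ M.bimodule (M.F (Icc 0 (s : ℝ)))) (hy : y ∈ M.bimodule (M.F (Icc 0 (t : ℝ)))) :
    x + M.shift s y ∈ M.bimodule (M.F (Icc 0 ((s + t : ℝ≥0) : ℝ))) := by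
  rw [NNReal.coe_add]
  exact add_mem (bimodule_Icc_mono le_rfl (le_add_of_nonneg_right t.coe_nonneg) hx)
    (bimodule_Icc_mono s.coe_nonneg le_rfl (shift_mem_bimodule s hy))

theorem add_shift_mem_centred {s t : ℝ≥0} {x y : H →L[ℂ] H} (hx : x ∈ M.centred s)
    (hy : y ∈ M.centred t) : x + M.shift s y ∈ M.centred (s + t) := by
  rw [mem_centred] at *
  refine ⟨add_shift_mem_bimodule hx.1 hy.1, ?_⟩
  rw [mul_add, e₀_mul_shift, hx.2, hy.2, add_zero]

theorem mem_centred_of_tendsto {t : ℝ≥0} {x : ℕ → H →L[ℂ] H} {y : H →L[ℂ] H}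
    (hx : ∀ n, x n ∈ M.centred t) (h : Tendsto x atTop (𝓝 y)) : y ∈ M.centred t := by
  rw [mem_centred]
  refine ⟨ExpectedSpace.mem_bimodule_of_tendsto (l := atTop)
    (fun n => (mem_centred.1 (hx n)).1) fun ξ => ?_, ?_⟩
  · exact ((ContinuousLinearMap.apply ℂ H ξ).continuous.tendsto y).comp h
  · refine tendsto_nhds_unique (h.const_mul M.e₀) (tendsto_const_nhds.congr fun n => ?_)
    exact (mem_centred.1 (hx n)).2.symm

/-- A centred future increment is orthogonal to the past. -/
theorem star_mul_shift_eq_zero {s t : ℝ≥0} {x y : H →L[ℂ] H}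
    (hx : x ∈ M.bimodule (M.F (Icc 0 (s : ℝ)))) (hy : y ∈ M.centred t) :
    star x * M.shift s y = 0 := by
  rw [mem_centred] at hy
  have h1 := ExpectedSpace.gnsProj_mul_of_mem (M.alg₀_subset_F Set.ordConnected_Icc) hx
  have h2 := M.past_mul (r := 0) (shift_mem_bimodule s hy.1)
  rw [e₀_mul_shift, hy.2] at h2
  rw [← h1, star_mul, M.star_gnsProj, mul_assoc, h2, mul_zero]

theorem star_add_shift_mul {s t : ℝ≥0} {x y : H →L[ℂ] H} (hx : x ∈ M.centred s)
    (hy : y ∈ M.centred t) :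
    star (x + M.shift s y) * (x + M.shift s y) = star x * x + star y * y := by
  have h1 := star_mul_shift_eq_zero (mem_centred.1 hx).1 hy
  have h2 := congrArg star h1
  rw [star_mul, star_star, star_zero] at h2
  have h3 : star (M.shift s y) * M.shift s y = star y * y := by
    rw [shift, star_mul, mul_assoc, ← mul_assoc (star (M.U s)), M.star_U_mul_U, one_mul]
  rw [star_add, add_mul, mul_add, mul_add, h1, h2, h3, add_zero, zero_add]

theorem norm_add_shift_sq_le {s t : ℝ≥0} {x y : H →L[ℂ] H} (hx : x ∈ M.centred s)
    (hy : y ∈ M.centred t) : ‖x + M.shift s y‖ ^ 2 ≤ ‖x‖ ^ 2 + ‖y‖ ^ 2 := by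
  rw [norm_sq_eq_norm_star_mul, star_add_shift_mul hx hy, norm_sq_eq_norm_star_mul x,
    norm_sq_eq_norm_star_mul y]
  exact norm_add_le _ _

/-- Pythagoras' inequality for orthogonal increments along a subdivision. -/
theorem sum_shift_mem_and_norm_sq_le : ∀ (n : ℕ) (p : Fin (n + 1) → ℝ≥0) (_ : Monotone p)
    (y : Fin n → H →L[ℂ] H) (_ : ∀ i, y i ∈ M.centred (p i.succ - p i.castSucc)),
    (∑ i, M.shift (p i.castSucc) (y i)) ∈ M.centred (p (Fin.last n)) ∧
      ‖∑ i, M.shift (p i.castSucc) (y i)‖ ^ 2 ≤ ∑ i, ‖y i‖ ^ 2 := by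
  intro n
  induction n with
  | zero => intro p _ y _; simp
  | succ n ih =>
    intro p hp y hy
    obtain ⟨h1, h2⟩ := ih (fun i => p i.castSucc) (fun i j hij => hp (by simpa using hij))
      (fun i => y i.castSucc) (fun i => hy i.castSucc)
    rw [Fin.sum_univ_castSucc, Fin.sum_univ_castSucc]
    have h3 := add_shift_mem_centred h1 (hy (Fin.last n))
    have h4 := norm_add_shift_sq_le h1 (hy (Fin.last n))
    rw [Fin.succ_last, add_tsub_cancel_of_le (hp (Fin.le_last _))] at h3
    exact ⟨h3, h4.trans (by gcongr)⟩

theorem sum_shift_eq {c : ℝ≥0 → H →L[ℂ] H} (h0 : c 0 = 0)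
    (hc : ∀ s t : ℝ≥0, c (s + t) = c s + M.shift s (c t)) : ∀ (n : ℕ) (p : Fin (n + 1) → ℝ≥0)
    (_ : Monotone p) (_ : p 0 = 0),
    ∑ i : Fin n, M.shift (p i.castSucc) (c (p i.succ - p i.castSucc)) = c (p (Fin.last n)) := by
  intro n
  induction n with
  | zero => intro p _ hp0; simp [hp0, h0]
  | succ n ih =>
    intro p hp hp0
    have h1 := ih (fun i => p i.castSucc) (fun i j hij => hp (by simpa using hij)) hp0
    rw [Fin.sum_univ_castSucc]
    have h2 : ∀ i : Fin n, p i.castSucc.succ = p i.succ.castSucc := fun i => rfl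
    simp only [h2]
    rw [h1, ← hc, Fin.succ_last, add_tsub_cancel_of_le (hp (Fin.le_last _))]

/-- A family of centred increments which splits at midpoints and is `O(h)` vanishes: by
orthogonality, halving the interval improves the constant by the factor `1/√2`. -/
theorem eq_zero_of_midpoint {k : ℝ≥0} {y : ℝ≥0 → H →L[ℂ] H} (hy : ∀ h, y h ∈ M.centred (k * h))
    (hmid : ∀ h, y h = y (h / 2) + M.shift ((k * (h / 2) : ℝ≥0) : ℝ) (y (h / 2))) {E : ℝ}
    (hE : ∀ h : ℝ≥0, ‖y h‖ ≤ E * h) (h : ℝ≥0) : y h = 0 := by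
  have hn : ∀ n : ℕ, ∀ h : ℝ≥0, ‖y h‖ ^ 2 ≤ E ^ 2 * (1 / 2) ^ n * (h : ℝ) ^ 2 := by
    intro n
    induction n with
    | zero =>
      intro h
      calc ‖y h‖ ^ 2 ≤ (E * h) ^ 2 := by gcongr; exact hE h
        _ = _ := by ring
    | succ n ih =>
      intro h
      have h1 := norm_add_shift_sq_le (hy (h / 2)) (hy (h / 2))
      rw [← hmid] at h1
      have h2 := ih (h / 2)
      push_cast at h2
      calc ‖y h‖ ^ 2 ≤ 2 * (E ^ 2 * (1 / 2) ^ n * ((h : ℝ) / 2) ^ 2) := by linarith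
        _ = _ := by ring
  have h1 : Tendsto (fun n : ℕ => E ^ 2 * (1 / 2 : ℝ) ^ n * (h : ℝ) ^ 2) atTop (𝓝 0) := by
    have := ((tendsto_pow_atTop_nhds_zero_of_lt_one (r := (1 / 2 : ℝ)) (by norm_num)
      (by norm_num)).const_mul (E ^ 2)).mul_const ((h : ℝ) ^ 2)
    simpa using this
  have h2 := ge_of_tendsto' h1 fun n => hn n h
  have h3 : ‖y h‖ = 0 := by
    have := sq_nonneg ‖y h‖
    exact pow_eq_zero_iff (two_ne_zero) |>.1 (le_antisymm h2 this)
  exact norm_eq_zero.1 h3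

variable (M) in
/-- One step of the dyadic refinement of a family of increments. -/
noncomputable def halve (x : ℝ≥0 → H →L[ℂ] H) (t : ℝ≥0) : H →L[ℂ] H :=
  x (t / 2) + M.shift ((t / 2 : ℝ≥0) : ℝ) (x (t / 2))

theorem halve_mem {x : ℝ≥0 → H →L[ℂ] H} (hx : ∀ t, x t ∈ M.centred t) (t : ℝ≥0) :
    M.halve x t ∈ M.centred t := by
  have := add_shift_mem_centred (hx (t / 2)) (hx (t / 2))
  rwa [add_halves] at this

/-- Dyadic refinement is a contraction for the norm `sup ‖x t‖ / t`, by orthogonality. -/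
theorem norm_halve_sub_le {x y : ℝ≥0 → H →L[ℂ] H} (hx : ∀ t, x t ∈ M.centred t)
    (hy : ∀ t, y t ∈ M.centred t) {E : ℝ} (hE : 0 ≤ E)
    (h : ∀ t : ℝ≥0, ‖x t - y t‖ ≤ E * t) (t : ℝ≥0) :
    ‖M.halve x t - M.halve y t‖ ≤ E * (Real.sqrt 2 / 2) * t := by
  have h1 : M.halve x t - M.halve y t =
      (x (t / 2) - y (t / 2)) + M.shift ((t / 2 : ℝ≥0) : ℝ) (x (t / 2) - y (t / 2)) := by
    rw [halve, halve, shift_sub]; abel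
  have h2 := norm_add_shift_sq_le (sub_mem (hx (t / 2)) (hy (t / 2)))
    (sub_mem (hx (t / 2)) (hy (t / 2)))
  rw [← h1] at h2
  have h3 := h (t / 2)
  push_cast at h3
  refine abs_le_of_sq_le_sq' ?_ (by positivity) |>.2
  have h4 : ‖x (t / 2) - y (t / 2)‖ ^ 2 ≤ (E * ((t : ℝ) / 2)) ^ 2 := by gcongr
  calc ‖M.halve x t - M.halve y t‖ ^ 2 ≤ 2 * (E * ((t : ℝ) / 2)) ^ 2 := by linarith
    _ = Real.sqrt 2 ^ 2 * (E * ((t : ℝ) / 2)) ^ 2 := by rw [Real.sq_sqrt (by norm_num)]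
    _ = _ := by ring

/-- A family of centred increments which is additive up to `O(s + t)` is within `O(t)` of an
additive family. -/
theorem exists_additive {v : ℝ≥0 → H →L[ℂ] H} (hv : ∀ t, v t ∈ M.centred t)
    (hvc : ∀ ξ, Continuous fun t => v t ξ) {C : ℝ} (hC : 0 ≤ C)
    (hadd : ∀ s t : ℝ≥0, ‖v (s + t) - (v s + M.shift s (v t))‖ ≤ C * (s + t)) :
    ∃ c : ℝ≥0 → H →L[ℂ] H, (∀ t, c t ∈ M.centred t) ∧
      (∀ s t : ℝ≥0, c (s + t) = c s + M.shift s (c t)) ∧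
      ∃ C', 0 ≤ C' ∧ ∀ t : ℝ≥0, ‖c t - v t‖ ≤ C' * t := by
  set r : ℝ := Real.sqrt 2 / 2 with hr
  have hr1 : r < 1 := by
    have : Real.sqrt 2 < 2 := by
      rw [Real.sqrt_lt' (by norm_num)]; norm_num
    rw [hr]; linarith
  have hr0 : 0 ≤ r := by positivity
  set x : ℕ → ℝ≥0 → H →L[ℂ] H := fun n => (M.halve)^[n] v with hx
  have hxs : ∀ n, x (n + 1) = M.halve (x n) := fun n => Function.iterate_succ_apply' _ _ _
  have hxm : ∀ n t, x n t ∈ M.centred t := by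
    intro n
    induction n with
    | zero => exact hv
    | succ n ih => rw [hxs]; exact halve_mem ih
  have hstep : ∀ n, ∀ t : ℝ≥0, ‖x n t - x (n + 1) t‖ ≤ C * r ^ n * t := by
    intro n
    induction n with
    | zero =>
      intro t
      have := hadd (t / 2) (t / 2)
      rw [add_halves] at this
      refine this.trans_eq ?_
      push_cast
      ring
    | succ n ih =>
      intro t
      rw [hxs (n + 1), hxs n]
      refine (norm_halve_sub_le (E := C * r ^ n) (hxm n) (halve_mem (hxm n)) (by positivity)
        (by rw [← hxs]; exact ih) t).trans_eq ?_
      rw [← hr]; ring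
  have hdist : ∀ t n, dist (x n t) (x (n + 1) t) ≤ C * t * r ^ n := fun t n => by
    rw [dist_eq_norm]
    exact (hstep n t).trans_eq (by ring)
  have hlim : ∀ t, ∃ y, Tendsto (fun n => x n t) atTop (𝓝 y) := fun t =>
    cauchySeq_tendsto_of_complete (cauchySeq_of_le_geometric r (C * t) hr1 (hdist t))
  choose c hc using hlim
  have hcm : ∀ t, c t ∈ M.centred t := fun t => mem_centred_of_tendsto (fun n => hxm n t) (hc t)
  have hxc : ∀ t n, ‖x n t - c t‖ ≤ C * t * r ^ n / (1 - r) := fun t n => by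
    rw [← dist_eq_norm]
    exact dist_le_of_le_geometric_of_tendsto r _ hr1 (hdist t) (hc t) n
  set C' := C / (1 - r) with hC'
  have hC'0 : 0 ≤ C' := div_nonneg hC (sub_nonneg.2 hr1.le)
  have hcv : ∀ t : ℝ≥0, ‖c t - v t‖ ≤ C' * t := by
    intro t
    rw [norm_sub_rev]
    refine (hxc t 0).trans_eq ?_
    rw [hC', pow_zero]; ring
  have hmid : ∀ t, c t = c (t / 2) + M.shift ((t / 2 : ℝ≥0) : ℝ) (c (t / 2)) := by
    intro t
    refine tendsto_nhds_unique ((hc t).comp (tendsto_add_atTop_nat 1)) ?_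
    have h1 := (hc (t / 2)).add ((hc (t / 2)).const_mul (M.U ((t / 2 : ℝ≥0) : ℝ)))
    refine h1.congr fun n => ?_
    rw [Function.comp_apply, hxs]
    rfl
  -- `t ↦ U_t` is only strongly continuous, so refinement preserves strong, not norm, continuity
  have hcc : ∀ ξ, Continuous fun t => c t ξ := by
    intro ξ
    have hxcont : ∀ n, ∀ ξ, Continuous fun t => x n t ξ := by
      intro n
      induction n with
      | zero => exact hvc
      | succ n ih =>
        intro ξ
        rw [hxs]
        have h2 : Continuous fun t : ℝ≥0 => t / 2 := continuous_id.div_const 2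
        exact ((ih ξ).comp h2).add (M.continuous_shift_apply (NNReal.continuous_coe.comp h2)
          (fun η => (ih η).comp h2) ξ)
    have hloc : TendstoLocallyUniformly (fun n t => x n t ξ) (fun t => c t ξ) atTop := by
      rw [Metric.tendstoLocallyUniformly_iff]
      intro ε hε t
      refine ⟨Iio (t + 1), Iio_mem_nhds (lt_add_one t), ?_⟩
      have h1 : Tendsto (fun n => C * (t + 1) * r ^ n / (1 - r) * ‖ξ‖) atTop (𝓝 0) := by
        have := (((tendsto_pow_atTop_nhds_zero_of_lt_one hr0 hr1).const_mul
          (C * ((t : ℝ) + 1))).div_const (1 - r)).mul_const ‖ξ‖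
        simpa using this
      filter_upwards [h1.eventually_lt_const hε] with n hn s hs
      rw [dist_comm, dist_eq_norm]
      refine lt_of_le_of_lt ?_ hn
      have h2 := (x n s - c s).le_of_opNorm_le (hxc s n) ξ
      refine h2.trans ?_
      have h3 : (s : ℝ) ≤ t + 1 := by exact_mod_cast (le_of_lt hs)
      have h4 : 0 ≤ 1 - r := sub_nonneg.2 hr1.le
      gcongr
    exact hloc.continuous (Frequently.of_forall fun n => hxcont n ξ)
  -- `w k h` is the sum of `k` shifted copies of the increment of length `h`
  set w : ℕ → ℝ≥0 → H →L[ℂ] H := fun k h =>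
    ∑ i ∈ Finset.range k, M.shift ((i * h : ℝ≥0) : ℝ) (c h) with hw
  have hws : ∀ k h, w (k + 1) h = w k h + M.shift ((k * h : ℝ≥0) : ℝ) (c h) := fun k h =>
    Finset.sum_range_succ _ _
  have hw0 : ∀ h, w 0 h = 0 := fun h => Finset.sum_range_zero _
  have hwadd : ∀ j k h, w (j + k) h = w j h + M.shift ((j * h : ℝ≥0) : ℝ) (w k h) := by
    intro j k h
    induction k with
    | zero => rw [hw0, shift_zero_right, add_zero, add_zero]
    | succ k ih =>
      rw [← add_assoc, hws, ih, hws, shift_add, shift_shift]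
      push_cast
      rw [← add_mul, add_assoc]
  have hwm : ∀ (k : ℕ) (h : ℝ≥0), w k h ∈ M.centred (k * h) := by
    intro k h
    induction k with
    | zero => rw [hw0]; exact zero_mem _
    | succ k ih =>
      have := add_shift_mem_centred ih (hcm h)
      rw [hws]
      convert this using 2
      push_cast; ring
  have hwhalf : ∀ k h, w k h = w k (h / 2) + M.shift ((k * (h / 2) : ℝ≥0) : ℝ) (w k (h / 2)) := by
    intro k h
    rw [← hwadd]
    induction k with
    | zero => rw [hw0, hw0]
    | succ k ih =>
      have h2 : w 2 (h / 2) = c h := by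
        rw [hws 1, hws 0, hw0, hmid h]
        simp [shift_zero]
      have h3 : k + 1 + (k + 1) = (k + k) + 2 := by ring
      rw [hws, h3, hwadd (k + k) 2, ← ih, h2]
      congr 3
      push_cast
      ring
  -- `c` inherits additivity up to `O(s + t)` from `v`; hence `c (k h) - w k h` is `O(h)` for
  -- fixed `k`, and it splits at midpoints, so that it vanishes
  set C'' := C + 3 * C'
  have hcadd : ∀ s t : ℝ≥0, ‖c (s + t) - (c s + M.shift s (c t))‖ ≤ C'' * (s + t) := by
    intro s t
    have h1 : c (s + t) - (c s + M.shift s (c t)) = (c (s + t) - v (s + t)) +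
        (v (s + t) - (v s + M.shift s (v t))) - (c s - v s) - M.shift s (c t - v t) := by
      rw [shift_sub]; abel
    rw [h1]
    have h2 := hcv (s + t)
    push_cast at h2
    have h3 := hadd s t
    have h4 := hcv s
    have h5 := hcv t
    rw [← M.norm_shift s] at h5
    refine (norm_sub_le _ _).trans ?_
    have h6 := norm_sub_le (c (s + t) - v (s + t) +
        (v (s + t) - (v s + M.shift s (v t)))) (c s - v s)
    have h7 := norm_add_le (c (s + t) - v (s + t)) (v (s + t) - (v s + M.shift s (v t)))
    have h8 : C'' * ((s : ℝ) + t) = C' * (s + t) + C * (s + t) + C' * (s + t) + C' * (s + t) := by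
      ring
    have h9 : 0 ≤ C' * (s : ℝ) := by positivity
    have h10 : 0 ≤ C' * (t : ℝ) := by positivity
    linarith
  have hwb : ∀ k : ℕ, ∃ E, ∀ h : ℝ≥0, ‖c (k * h) - w k h‖ ≤ E * h := by
    intro k
    induction k with
    | zero =>
      refine ⟨0, fun h => ?_⟩
      have := hcv 0
      have h0 : ‖v 0‖ ≤ 0 := by
        have := hadd 0 0
        simpa [shift_zero] using this
      rw [norm_le_zero_iff] at h0
      simpa [hw0, h0] using this
    | succ k ih =>
      obtain ⟨E, hE⟩ := ih
      refine ⟨E + C'' * (k + 1), fun h => ?_⟩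
      have h1 := hcadd (k * h) h
      have h2 : ((k + 1 : ℕ) : ℝ≥0) * h = k * h + h := by push_cast; ring
      rw [h2, hws]
      have h3 : c (k * h + h) - (w k h + M.shift ((k * h : ℝ≥0) : ℝ) (c h)) =
          (c (k * h + h) - (c (k * h) + M.shift ((k * h : ℝ≥0) : ℝ) (c h))) +
            (c (k * h) - w k h) := by abel
      rw [h3]
      refine (norm_add_le _ _).trans ?_
      have h4 := hE h
      rw [NNReal.coe_mul, NNReal.coe_natCast] at h1 ⊢
      linarith
  have hcw : ∀ (k : ℕ) (h : ℝ≥0), c (k * h) = w k h := by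
    intro k h
    obtain ⟨E, hE⟩ := hwb k
    refine sub_eq_zero.1 (eq_zero_of_midpoint (M := M) (k := k) (y := fun h => c (k * h) - w k h)
      (fun h => sub_mem (hcm _) (hwm k h)) (fun h => ?_) hE h)
    have h1 := hmid (k * h)
    rw [mul_div_assoc] at h1
    have h2 := hwhalf k h
    rw [shift_sub]
    nth_rw 1 [h1]
    nth_rw 1 [h2]
    abel
  have hcom : ∀ (j k : ℕ) (h : ℝ≥0),
      c (j * h + k * h) = c (j * h) + M.shift ((j * h : ℝ≥0) : ℝ) (c (k * h)) := by
    intro j k h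
    rw [hcw, hcw, ← hwadd, ← hcw]
    congr 1
    push_cast; ring
  refine ⟨c, hcm, fun s t => ?_, C', hC'0, hcv⟩
  -- approximation of `t` by multiples of `s / n`
  rcases eq_or_ne s 0 with rfl | hs
  · have h0 := hcom 0 0 0
    have h1 := hcw 0 0
    rw [hw0] at h1
    simp only [CharP.cast_eq_zero, zero_mul] at h1
    rw [h1, zero_add, zero_add, NNReal.coe_zero, shift_zero]
  set q : ℕ → ℕ := fun n => ⌊((t / s : ℝ≥0) : ℝ) * (n : ℝ)⌋₊ with hq
  set τ : ℕ → ℝ≥0 := fun n => (q n : ℝ≥0) / n * s with hτ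
  have hτt : Tendsto τ atTop (𝓝 t) := by
    have h1 := ((tendsto_nat_floor_mul_div_atTop (R := ℝ) (t / s : ℝ≥0).coe_nonneg).comp
      (tendsto_natCast_atTop_atTop (R := ℝ))).mul_const (s : ℝ)
    rw [← NNReal.coe_mul, div_mul_cancel₀ _ hs] at h1
    rw [← NNReal.tendsto_coe]
    refine h1.congr fun n => ?_
    simp [hτ, hq]
  have hτadd : ∀ n : ℕ, 0 < n → c (s + τ n) = c s + M.shift s (c (τ n)) := by
    intro n hn
    have h1 := hcom n (q n) (s / n)
    have hn' : (n : ℝ≥0) ≠ 0 := by exact_mod_cast hn.ne'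
    have h2 : (n : ℝ≥0) * (s / n) = s := by field_simp
    have h3 : (q n : ℝ≥0) * (s / n) = τ n := by simp only [hτ]; ring
    rwa [h2, h3] at h1
  ext ξ
  refine tendsto_nhds_unique (f := fun n => c (s + τ n) ξ) (l := atTop)
    (((hcc ξ).tendsto _).comp (hτt.const_add s)) ?_
  have h1 : Tendsto (fun n => (c s + M.shift s (c (τ n))) ξ) atTop
      (𝓝 ((c s + M.shift s (c t)) ξ)) :=
    ((((M.U s).continuous.tendsto _).comp (((hcc ξ).tendsto _).comp hτt)).const_add (c s ξ))
  refine h1.congr' ?_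
  filter_upwards [eventually_gt_atTop 0] with n hn
  rw [hτadd n hn]

end BernoulliShift

end CBS

/-! ### The centred part of a unital cocycle -/

namespace CBS

theorem isClosed_vonNeumannAlgebra {H : Type*} [NormedAddCommGroup H] [InnerProductSpace ℂ H]
    [CompleteSpace H] (B : VonNeumannAlgebra H) : IsClosed (B : Set (H →L[ℂ] H)) := by
  rw [← B.centralizer_centralizer]
  exact Set.isClosed_centralizer _

/-- An additive function on `ℝ≥0` which is `o(t)` at zero vanishes. -/
theorem eq_zero_of_additive {E : Type*} [NormedAddCommGroup E] [NormedSpace ℝ E] {g : ℝ≥0 → E}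
    (hg : ∀ s t, g (s + t) = g s + g t) {ε : ℝ≥0 → ℝ} (hε : Tendsto ε (𝓝 0) (𝓝 0))
    (h : ∀ t : ℝ≥0, ‖g t‖ ≤ t * ε t) (t : ℝ≥0) : g t = 0 := by
  have h0 : g 0 = 0 := by simpa using hg 0 0
  have hn : ∀ (n : ℕ) (t : ℝ≥0), g (n * t) = (n : ℝ) • g t := by
    intro n t
    induction n with
    | zero => simp [h0]
    | succ n ih =>
      have h1 : ((n + 1 : ℕ) : ℝ≥0) * t = n * t + t := by push_cast; ring
      rw [h1, hg, ih]
      push_cast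
      rw [add_smul, one_smul]
  have hb : ∀ n : ℕ, 0 < n → ‖g t‖ ≤ t * ε (t / n) := by
    intro n hpos
    have hn' : (n : ℝ≥0) ≠ 0 := by exact_mod_cast hpos.ne'
    have h1 := hn n (t / n)
    rw [mul_div_cancel₀ _ hn'] at h1
    have h2 := h (t / n)
    push_cast at h2
    have h3 : (0 : ℝ) < n := by exact_mod_cast hpos
    rw [h1, norm_smul, Real.norm_of_nonneg h3.le]
    calc (n : ℝ) * ‖g (t / n)‖ ≤ n * ((t : ℝ) / n * ε (t / n)) := by gcongr
      _ = t * ε (t / n) := by field_simp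
  have hlim : Tendsto (fun n : ℕ => (t : ℝ) * ε (t / n)) atTop (𝓝 0) := by
    have h1 : Tendsto (fun n : ℕ => t / (n : ℝ≥0)) atTop (𝓝 0) := by
      rw [← NNReal.tendsto_coe]
      push_cast
      exact tendsto_const_div_atTop_nhds_zero_nat _
    simpa using (hε.comp h1).const_mul (t : ℝ)
  have h2 : ‖g t‖ ≤ 0 := by
    refine ge_of_tendsto hlim ?_
    filter_upwards [eventually_gt_atTop 0] with n hpos using hb n hpos
  exact norm_le_zero_iff.1 h2

theorem Partition.sum_step {t : ℝ≥0} (Z : Partition t) : ∑ i, (Z.step i : ℝ) = t := by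
  have h1 : ∀ i, (Z.step i : ℝ) = Z.pt i.succ - Z.pt i.castSucc := fun i =>
    NNReal.coe_sub (Z.strictMono.monotone (Fin.castSucc_le_succ i))
  simp only [h1]
  rw [Finset.sum_sub_distrib]
  have h2 := Fin.sum_univ_succ fun i => (Z.pt i : ℝ)
  have h3 := Fin.sum_univ_castSucc fun i => (Z.pt i : ℝ)
  rw [Z.pt_zero] at h2
  rw [Z.pt_last] at h3
  simp only [NNReal.coe_zero, zero_add] at h2
  linarith

theorem Partition.sum_step_sq_le {t : ℝ≥0} (Z : Partition t) :
    ∑ i, (Z.step i : ℝ) ^ 2 ≤ Z.mesh * t := by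
  rw [← Z.sum_step, Finset.mul_sum]
  refine Finset.sum_le_sum fun i hi => ?_
  rw [sq]
  gcongr
  exact_mod_cast Finset.le_sup (f := Z.step) hi

theorem tendsto_mesh (t : ℝ≥0) : Tendsto (fun Z : Partition t => (Z.mesh : ℝ)) (fine t) (𝓝 0) := by
  have h1 : Tendsto (Partition.mesh (t := t)) (fine t) (𝓝 0) := tendsto_comap
  exact NNReal.tendsto_coe.2 h1

namespace BernoulliShift

variable {H : Type*} [NormedAddCommGroup H] [InnerProductSpace ℂ H]
  [CompleteSpace H] [TopologicalSpace.SeparableSpace H] {M : BernoulliShift H}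

theorem adapted_mem {u : ℝ≥0 → H →L[ℂ] H} (hu : M.IsUnitalCocycle u) (t : ℝ≥0) :
    u t ∈ M.bimodule (M.F (Icc 0 (t : ℝ))) :=
  M.mem_bimodule.2 (hu.adapted t)

theorem e₀_mul_cocycle {u : ℝ≥0 → H →L[ℂ] H} (hu : M.IsUnitalCocycle u) (s t : ℝ≥0) :
    M.e₀ * u (t + s) = M.e₀ * u s * u t := by
  rw [(hu.cocycle s t).e₀_mul (B := M.F (Icc 0 (t : ℝ))) (M.F_subset _ Set.ordConnected_Icc)
    (fun a ha => M.past_compress ha)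
    (ExpectedSpace.gnsProj_mul_of_mem (M.alg₀_subset_F Set.ordConnected_Icc) (adapted_mem hu t))
    (M.e₀_mul_gnsProj (M.alg₀_subset_F Set.ordConnected_Icc)), e₀_mul_shift]

/-- At time zero the cocycle is trivial: the algebra of a point is independent of itself, so that
`u 0 = E₀ (u 0)` is an isometric idempotent. -/
theorem cocycle_zero {u : ℝ≥0 → H →L[ℂ] H} (hu : M.IsUnitalCocycle u) : u 0 = M.e₀ := by
  have h1 := M.past_mul (r := 0) (s := 0) (t := 0) (adapted_mem hu 0)
  have h2 := ExpectedSpace.gnsProj_mul_of_mem (M.alg₀_subset_F Set.ordConnected_Icc)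
    (adapted_mem hu 0)
  rw [NNReal.coe_zero] at h2
  rw [h2] at h1
  have h3 := e₀_mul_cocycle hu 0 0
  rw [add_zero, ← h1] at h3
  have h4 := hu.unital 0
  rw [inner₀] at h4
  calc u 0 = M.e₀ * u 0 := h1
    _ = star (u 0) * (u 0 * u 0) := by rw [← h4, mul_assoc]
    _ = M.e₀ := by rw [← h3, h4]

theorem norm_cocycle_le {u : ℝ≥0 → H →L[ℂ] H} (hu : M.IsUnitalCocycle u) (t : ℝ≥0) :
    ‖u t‖ ≤ 1 := by
  have h1 := norm_sq_eq_norm_star_mul (u t)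
  have h2 := hu.unital t
  rw [inner₀] at h2
  rw [h2] at h1
  have h3 := M.norm_e₀_le
  nlinarith [norm_nonneg (u t)]

/-- The expectation of a norm continuous unital cocycle is a contraction semigroup `e^{tK}` in
`A₀`. -/
theorem exists_expect_eq_exp {u : ℝ≥0 → H →L[ℂ] H} (hu : M.IsUnitalCocycle u)
    (hcont : Continuous u) :
    ∃ K ∈ M.alg₀, (∀ t : ℝ≥0, NormedSpace.exp (((t : ℝ) : ℂ) • K) ∈ M.alg₀) ∧
      (∀ t : ℝ≥0, NormedSpace.exp (((t : ℝ) : ℂ) • K) * M.e₀ = M.e₀ * u t) ∧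
      ∀ t : ℝ, 0 ≤ t → ‖NormedSpace.exp ((t : ℂ) • K)‖ ≤ 1 := by
  have h1 := fun t => ExpectedSpace.exists_expect_eq (M.F_subset _ Set.ordConnected_Icc)
    (adapted_mem hu t)
  choose α hα hαe hαn using h1
  have h0 : α 0 = 1 := by
    refine M.eq_of_mul_gnsProj_eq M.alg₀_subset (hα 0) (one_mem _) ?_
    rw [← ExpectedSpace.e₀_eq_gnsProj, hαe, cocycle_zero hu, M.e₀_mul_e₀, one_mul]
  have hadd : ∀ s t, α (s + t) = α s * α t := by
    intro s t
    refine M.eq_of_mul_gnsProj_eq M.alg₀_subset (hα _) (mul_mem (hα s) (hα t)) ?_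
    rw [← ExpectedSpace.e₀_eq_gnsProj, hαe, add_comm, e₀_mul_cocycle hu, ← hαe s, mul_assoc,
      ← hαe, mul_assoc]
  have hc : Continuous α := by
    rw [continuous_iff_continuousAt]
    intro t
    rw [ContinuousAt, tendsto_iff_norm_sub_tendsto_zero]
    have h2 := tendsto_iff_norm_sub_tendsto_zero.1 (hcont.tendsto t)
    refine squeeze_zero (fun _ => norm_nonneg _) (fun s => ?_) h2
    refine (M.norm_le_norm_mul_e₀ (sub_mem (hα s) (hα t))).trans ?_
    rw [sub_mul, hαe, hαe, ← mul_sub]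
    exact (norm_mul_le _ _).trans (mul_le_of_le_one_left (norm_nonneg _) M.norm_e₀_le)
  obtain ⟨K, hK, hKB⟩ := exists_generator hc h0 hadd
  refine ⟨K, hKB M.alg₀.toStarSubalgebra.toSubalgebra.toSubmodule
    (isClosed_vonNeumannAlgebra M.alg₀) hα, fun t => ?_, fun t => ?_, fun t ht => ?_⟩
  · rw [← hK]; exact hα t
  · rw [← hK]; exact hαe t
  · have h2 := hK ⟨t, ht⟩
    have h3 := hαn ⟨t, ht⟩
    rw [h2] at h3
    refine h3.trans ((norm_mul_le _ _).trans ?_)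
    exact mul_le_one₀ M.norm_e₀_le (norm_nonneg _) (norm_cocycle_le hu _)

/-- The centred part `u_t - E₀ u_t` of a unital cocycle. -/
noncomputable def centredPart (M : BernoulliShift H) (u : ℝ≥0 → H →L[ℂ] H) (t : ℝ≥0) :
    H →L[ℂ] H :=
  u t - M.e₀ * u t

theorem centredPart_mem {u : ℝ≥0 → H →L[ℂ] H} (hu : M.IsUnitalCocycle u) (t : ℝ≥0) :
    M.centredPart u t ∈ M.centred t := by
  obtain ⟨a, ha, hae, -⟩ := ExpectedSpace.exists_expect_eq (M.F_subset _ Set.ordConnected_Icc)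
    (adapted_mem hu t)
  rw [mem_centred, centredPart]
  constructor
  · rw [← hae]
    exact sub_mem (adapted_mem hu t)
      (ExpectedSpace.mul_e₀_mem_bimodule (M.alg₀_subset_F Set.ordConnected_Icc ha))
  · rw [mul_sub, ← mul_assoc, M.e₀_mul_e₀, sub_self]

theorem star_centredPart_mul {u : ℝ≥0 → H →L[ℂ] H} (hu : M.IsUnitalCocycle u) {t : ℝ≥0}
    {a : H →L[ℂ] H} (ha : a ∈ M.alg₀) (hae : a * M.e₀ = M.e₀ * u t) :
    star (M.centredPart u t) * M.centredPart u t = (1 - star a * a) * M.e₀ := by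
  have h1 := hu.unital t
  rw [inner₀] at h1
  have h2 : star (u t) * M.e₀ = M.e₀ * star a := by
    have := congrArg star hae
    rw [star_mul, star_mul, M.star_e₀] at this
    exact this.symm
  have h3 := M.commute_e₀ (star_mem ha)
  calc star (M.centredPart u t) * M.centredPart u t
      = star (u t) * u t - star (u t) * M.e₀ * u t - star (u t) * M.e₀ * u t +
          star (u t) * (M.e₀ * M.e₀) * u t := by
        rw [centredPart, star_sub, star_mul, M.star_e₀]; noncomm_ring
    _ = M.e₀ - star a * (M.e₀ * u t) := by
        rw [M.e₀_mul_e₀, h1, h2, ← h3]; noncomm_ring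
    _ = (1 - star a * a) * M.e₀ := by rw [← hae]; noncomm_ring

/-- The quantitative estimates for the centred part of a cocycle: it is of order `√t`, its square
is `-t (K^* + K)` up to `O(t²)`, and it is additive up to `O(s + t)`. -/
theorem centredPart_estimates {u : ℝ≥0 → H →L[ℂ] H} (hu : M.IsUnitalCocycle u) {K : H →L[ℂ] H}
    (hα : ∀ t : ℝ≥0, NormedSpace.exp (((t : ℝ) : ℂ) • K) ∈ M.alg₀)
    (hαe : ∀ t : ℝ≥0, NormedSpace.exp (((t : ℝ) : ℂ) • K) * M.e₀ = M.e₀ * u t)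
    (hK : ∀ t : ℝ, 0 ≤ t → ‖NormedSpace.exp ((t : ℂ) • K)‖ ≤ 1) :
    (∀ t : ℝ≥0, ‖M.centredPart u t‖ ^ 2 ≤ 2 * ‖K‖ * t) ∧
    (∀ t : ℝ≥0, ‖star (M.centredPart u t) * M.centredPart u t +
      ((t : ℝ) : ℂ) • ((star K + K) * M.e₀)‖ ≤ 3 * ‖K‖ ^ 2 * (t : ℝ) ^ 2) ∧
    ∀ s t : ℝ≥0, ‖M.centredPart u (s + t) -
      (M.centredPart u s + M.shift s (M.centredPart u t))‖ ≤ 3 * ‖K‖ * (s + t) := by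
  set α : ℝ≥0 → H →L[ℂ] H := fun t => NormedSpace.exp (((t : ℝ) : ℂ) • K) with hαdef
  have hα1 : ∀ t : ℝ≥0, ‖α t - 1‖ ≤ t * ‖K‖ := fun t => norm_exp_smul_sub_one_le hK t.coe_nonneg
  have hα2 : ∀ t : ℝ≥0, ‖α t - 1 - ((t : ℝ) : ℂ) • K‖ ≤ ‖K‖ ^ 2 * (t : ℝ) ^ 2 := fun t =>
    norm_exp_smul_sub_one_sub_le hK t.coe_nonneg
  have hαn : ∀ t : ℝ≥0, ‖α t‖ ≤ 1 := fun t => hK t t.coe_nonneg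
  have he : ∀ x : H →L[ℂ] H, ‖x * M.e₀‖ ≤ ‖x‖ := fun x =>
    (norm_mul_le _ _).trans (mul_le_of_le_one_right (norm_nonneg _) M.norm_e₀_le)
  have hsq : ∀ t : ℝ≥0, ‖M.centredPart u t‖ ^ 2 ≤ 2 * ‖K‖ * t := by
    intro t
    rw [norm_sq_eq_norm_star_mul, star_centredPart_mul hu (hα t) (hαe t)]
    refine (he _).trans ?_
    have h1 : 1 - star (α t) * α t = -(star (α t - 1)) - star (α t) * (α t - 1) := by
      rw [star_sub, star_one]; noncomm_ring
    rw [h1]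
    refine (norm_sub_le _ _).trans ?_
    have h2 := norm_mul_le (star (α t)) (α t - 1)
    rw [norm_star] at h2
    have h3 : ‖α t‖ * ‖α t - 1‖ ≤ 1 * (t * ‖K‖) := by
      gcongr
      · exact hαn t
      · exact hα1 t
    rw [norm_neg, norm_star]
    linarith [hα1 t]
  have hu1 := norm_cocycle_le hu
  have hv2 : ∀ t, ‖M.centredPart u t‖ ≤ 2 := by
    intro t
    rw [centredPart]
    refine (norm_sub_le _ _).trans ?_
    have h1 := norm_mul_le M.e₀ (u t)
    have h2 : ‖M.e₀‖ * ‖u t‖ ≤ 1 := mul_le_one₀ M.norm_e₀_le (norm_nonneg _) (hu1 t)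
    linarith [hu1 t]
  refine ⟨hsq, fun t => ?_, fun s t => ?_⟩
  · rw [star_centredPart_mul hu (hα t) (hαe t)]
    have h1 : (1 - star (α t) * α t) * M.e₀ + ((t : ℝ) : ℂ) • ((star K + K) * M.e₀) =
        (-(star (α t - 1 - ((t : ℝ) : ℂ) • K)) - (α t - 1 - ((t : ℝ) : ℂ) • K) -
          star (α t - 1) * (α t - 1)) * M.e₀ := by
      have h2 : star (((t : ℝ) : ℂ) • K) = ((t : ℝ) : ℂ) • star K := by
        rw [star_smul]; simp
      rw [star_sub, h2, star_sub, star_one, ← smul_mul_assoc, smul_add]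
      noncomm_ring
    rw [h1]
    refine (he _).trans ?_
    refine (norm_sub_le _ _).trans ?_
    have h2 := norm_sub_le (-(star (α t - 1 - ((t : ℝ) : ℂ) • K)))
      (α t - 1 - ((t : ℝ) : ℂ) • K)
    rw [norm_neg, norm_star] at h2
    rw [CStarRing.norm_star_mul_self]
    have h3 : ‖α t - 1‖ * ‖α t - 1‖ ≤ (t * ‖K‖) * (t * ‖K‖) := by
      gcongr <;> exact hα1 t
    have h4 := hα2 t
    nlinarith
  · -- `hp` bounds the product of the centred parts, obtained by centring both factors of
    -- `u_{s+t} = (S_s u_t) u_s`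
    have hp := ((hu.cocycle t s).sub_right.sub_expect (M.F_subset _ Set.ordConnected_Icc)
      (M.alg₀_subset_F Set.ordConnected_Icc) (hα t)
      (by rw [hαe, e₀_mul_shift])).norm_le (M.F_subset _ Set.ordConnected_Icc)
      (fun a ha => M.past_compress (r := 0) ha)
      (ExpectedSpace.gnsProj_mul_of_mem (M.alg₀_subset_F Set.ordConnected_Icc)
        (mem_centred.1 (centredPart_mem hu s)).1)
    have hw : M.shift s (u t) - α t * M.e₀ = M.shift s (M.centredPart u t) := by
      rw [centredPart, shift_sub, ← hαe, hαdef]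
      simp only
      have h1 : M.shift s (NormedSpace.exp (((t : ℝ) : ℂ) • K) * M.e₀) =
          NormedSpace.exp (((t : ℝ) : ℂ) • K) * M.e₀ := by
        rw [M.commute_e₀ (hα t), shift, ← mul_assoc, M.U_mul_e₀]
      rw [h1]
    rw [hw, norm_shift] at hp
    have hy : u s - M.e₀ * u s = M.centredPart u s := rfl
    rw [hy] at hp
    -- the error is `(S_s v_t) v_s + S_s v_t (A_s - 1) + (A_t - 1) v_s`
    have hd : M.centredPart u (s + t) - (M.centredPart u s + M.shift s (M.centredPart u t)) =
        (u (s + t) - M.shift s (u t) * u s - α t * M.centredPart u s) +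
        M.shift s (M.centredPart u t) * ((α s - 1) * M.e₀) + (α t - 1) * M.centredPart u s := by
      have h1 : M.shift s (M.centredPart u t) * ((α s - 1) * M.e₀) =
          M.shift s (M.centredPart u t) * (M.e₀ * u s) - M.shift s (M.centredPart u t) := by
        have h2 : M.shift s (M.centredPart u t) * M.e₀ = M.shift s (M.centredPart u t) := by
          rw [shift, mul_assoc,
            ExpectedSpace.mul_e₀_of_mem (mem_centred.1 (centredPart_mem hu t)).1]
        rw [sub_mul, one_mul, mul_sub, h2, hαe]
      have h3 : M.shift s (M.centredPart u t) * (M.e₀ * u s) =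
          M.shift s (u t) * u s - M.e₀ * u (s + t) := by
        rw [e₀_mul_cocycle hu, ← hw, sub_mul, ← hαe t]
        have h4 : M.shift s (u t) * (M.e₀ * u s) = M.shift s (u t) * u s := by
          rw [← mul_assoc, shift, mul_assoc (M.U s),
            ExpectedSpace.mul_e₀_of_mem (adapted_mem hu t)]
        have h5 : α t * M.e₀ * (M.e₀ * u s) = α t * M.e₀ * u s := by
          rw [← mul_assoc, mul_assoc (α t), M.e₀_mul_e₀]
        rw [h4, h5]
      rw [h1, h3, sub_mul, one_mul]
      have h6 : M.centredPart u (s + t) = u (s + t) - M.e₀ * u (s + t) := rfl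
      rw [h6]
      abel
    rw [hd]
    refine (norm_add₃_le).trans ?_
    have h1 : ‖M.shift s (M.centredPart u t) * ((α s - 1) * M.e₀)‖ ≤ 2 * (s * ‖K‖) := by
      refine (norm_mul_le _ _).trans ?_
      rw [norm_shift]
      gcongr
      · exact hv2 t
      · exact (he _).trans (hα1 s)
    have h2 : ‖(α t - 1) * M.centredPart u s‖ ≤ (t * ‖K‖) * 2 := by
      refine (norm_mul_le _ _).trans ?_
      gcongr
      · exact hα1 t
      · exact hv2 s
    have h3 := hsq s
    have h4 := hsq t
    nlinarith [sq_nonneg (‖M.centredPart u t‖ - ‖M.centredPart u s‖)]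

end BernoulliShift

end CBS

/-! ### Riemann sums and the structure equation -/

namespace CBS

namespace BernoulliShift

variable {H : Type*} [NormedAddCommGroup H] [InnerProductSpace ℂ H]
  [CompleteSpace H] [TopologicalSpace.SeparableSpace H] {M : BernoulliShift H}

theorem additive_zero {c : ℝ≥0 → H →L[ℂ] H}
    (hc : ∀ s t : ℝ≥0, c (s + t) = c s + M.shift s (c t)) : c 0 = 0 := by
  simpa [shift_zero] using hc 0 0

/-- An additive family which is `O(√t)` at zero is norm continuous, because its increments are
shifts of it. -/
theorem continuous_of_additive {c : ℝ≥0 → H →L[ℂ] H}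
    (hc : ∀ s t : ℝ≥0, c (s + t) = c s + M.shift s (c t)) {φ : ℝ → ℝ}
    (hφ : Tendsto φ (𝓝 0) (𝓝 0)) (h : ∀ t : ℝ≥0, ‖c t‖ ≤ φ t) : Continuous c := by
  have h1 : ∀ s t : ℝ≥0, ‖c t - c s‖ ≤ φ (dist t s) := by
    have h2 : ∀ s t : ℝ≥0, s ≤ t → ‖c t - c s‖ ≤ φ (dist t s) := by
      intro s t hst
      have h3 := hc s (t - s)
      rw [add_tsub_cancel_of_le hst] at h3
      rw [h3, add_sub_cancel_left, norm_shift]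
      refine (h (t - s)).trans_eq ?_
      rw [NNReal.dist_eq, abs_of_nonneg (sub_nonneg.2 (by exact_mod_cast hst)),
        NNReal.coe_sub hst]
    intro s t
    rcases le_total s t with hst | hst
    · exact h2 s t hst
    · rw [norm_sub_rev, dist_comm]
      exact h2 t s hst
  rw [continuous_iff_continuousAt]
  intro s
  rw [ContinuousAt, tendsto_iff_norm_sub_tendsto_zero]
  exact squeeze_zero (fun _ => norm_nonneg _) (h1 s)
    (hφ.comp (tendsto_iff_dist_tendsto_zero.1 tendsto_id))

/-- The Riemann sums of a centred family which is within `O(t)` of an additive family converge to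
the latter, since the errors on the subintervals are orthogonal. -/
theorem tendsto_riemann_sum {c v : ℝ≥0 → H →L[ℂ] H} (hcm : ∀ t, c t ∈ M.centred t)
    (hvm : ∀ t, v t ∈ M.centred t) (hc : ∀ s t : ℝ≥0, c (s + t) = c s + M.shift s (c t))
    {C : ℝ} (hcv : ∀ t : ℝ≥0, ‖c t - v t‖ ≤ C * t) (t : ℝ≥0) :
    Tendsto (fun Z : Partition t => ∑ i, M.shift (Z.pt i.castSucc) (v (Z.step i))) (fine t)
      (𝓝 (c t)) := by
  rw [tendsto_iff_norm_sub_tendsto_zero]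
  have h1 : Tendsto (fun Z : Partition t => Real.sqrt (C ^ 2 * (Z.mesh * t))) (fine t) (𝓝 0) := by
    have := (((tendsto_mesh t).mul_const (t : ℝ)).const_mul (C ^ 2)).sqrt
    simpa using this
  refine squeeze_zero (fun _ => norm_nonneg _) (fun Z => ?_) h1
  refine Real.le_sqrt_of_sq_le ?_
  have h2 := sum_shift_eq (additive_zero hc) hc Z.n Z.pt Z.strictMono.monotone Z.pt_zero
  rw [Z.pt_last] at h2
  have h3 : (∑ i, M.shift (Z.pt i.castSucc) (v (Z.step i))) - c t =
      ∑ i, M.shift (Z.pt i.castSucc) (v (Z.step i) - c (Z.step i)) := by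
    rw [← h2, ← Finset.sum_sub_distrib]
    refine Finset.sum_congr rfl fun i _ => ?_
    rw [shift_sub]
    rfl
  rw [h3]
  refine (sum_shift_mem_and_norm_sq_le Z.n Z.pt Z.strictMono.monotone
    (fun i => v (Z.step i) - c (Z.step i)) fun i => sub_mem (hvm _) (hcm _)).2.trans ?_
  refine le_trans ?_ (mul_le_mul_of_nonneg_left Z.sum_step_sq_le (sq_nonneg C))
  rw [Finset.mul_sum]
  refine Finset.sum_le_sum fun i _ => ?_
  rw [← mul_pow, norm_sub_rev]
  gcongr
  exact hcv _

/-- An additive family which is within `O(t)` of a family `v` with `v_t^* v_t = -t L + O(t²)`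
satisfies `c_t^* c_t = -t L`: the square is additive by orthogonality. -/
theorem star_mul_add_eq_zero {c v : ℝ≥0 → H →L[ℂ] H} {L : H →L[ℂ] H}
    (hcm : ∀ t, c t ∈ M.centred t) (hc : ∀ s t : ℝ≥0, c (s + t) = c s + M.shift s (c t))
    {C κ D : ℝ} (hC : 0 ≤ C) (hcv : ∀ t : ℝ≥0, ‖c t - v t‖ ≤ C * t)
    (hsq : ∀ t : ℝ≥0, ‖v t‖ ≤ Real.sqrt (κ * t))
    (hL : ∀ t : ℝ≥0, ‖star (v t) * v t + ((t : ℝ) : ℂ) • L‖ ≤ D * (t : ℝ) ^ 2) (t : ℝ≥0) :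
    star (c t) * c t + ((t : ℝ) : ℂ) • L = 0 := by
  refine eq_zero_of_additive (g := fun t : ℝ≥0 => star (c t) * c t + ((t : ℝ) : ℂ) • L)
    (fun s t => ?_) (ε := fun t : ℝ≥0 => C * (2 * Real.sqrt (κ * t) + C * t) + D * t) ?_
    (fun t => ?_) t
  · rw [hc, star_add_shift_mul (hcm s) (hcm t)]
    push_cast
    rw [add_smul]
    abel
  · have h1 : Continuous fun t : ℝ≥0 => C * (2 * Real.sqrt (κ * t) + C * t) + D * t := by fun_prop
    simpa using h1.tendsto 0
  · have h1 : star (c t) * c t + ((t : ℝ) : ℂ) • L = star (c t) * (c t - v t) +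
        star (c t - v t) * v t + (star (v t) * v t + ((t : ℝ) : ℂ) • L) := by
      rw [star_sub]; noncomm_ring
    have h2 : ‖c t‖ ≤ C * t + Real.sqrt (κ * t) := by
      have := norm_add_le (c t - v t) (v t)
      rw [sub_add_cancel] at this
      linarith [hcv t, hsq t]
    simp only [h1]
    refine norm_add₃_le.trans ?_
    have h3 : ‖star (c t) * (c t - v t)‖ ≤ (C * t + Real.sqrt (κ * t)) * (C * t) := by
      refine (norm_mul_le _ _).trans ?_
      rw [norm_star]
      gcongr
      exact hcv t
    have h4 : ‖star (c t - v t) * v t‖ ≤ (C * t) * Real.sqrt (κ * t) := by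
      refine (norm_mul_le _ _).trans ?_
      rw [norm_star]
      gcongr
      · exact hcv t
      · exact hsq t
    have h5 := hL t
    linarith

theorem shift_mul_e₀ (t : ℝ) {a : H →L[ℂ] H} (ha : a ∈ M.alg₀) :
    M.shift t (a * M.e₀) = a * M.e₀ := by
  rw [M.commute_e₀ ha, shift, ← mul_assoc, M.U_mul_e₀]

end BernoulliShift

end CBS

/-! ### The logarithm of a unital cocycle -/

theorem theorem8 {H : Type*} [NormedAddCommGroup H] [InnerProductSpace ℂ H] [CompleteSpace H]
    [TopologicalSpace.SeparableSpace H] (M : CBS.BernoulliShift H)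
    (u : ℝ≥0 → H →L[ℂ] H) (hu : M.IsUnitalCocycle u) (hcont : Continuous u) :
    ∃ K ∈ M.alg₀,
      (∀ t : ℝ≥0, M.expect (u t) = NormedSpace.exp (((t : ℝ) : ℂ) • K) * M.e₀) ∧
      (∀ t : ℝ≥0, ‖NormedSpace.exp (((t : ℝ) : ℂ) • K)‖ ≤ 1) ∧
      ∃ b c : ℝ≥0 → H →L[ℂ] H,
        (∀ t, Tendsto (fun Z : CBS.Partition t => M.logSum u Z) (CBS.fine t) (𝓝 (b t))) ∧
        (∀ t, Tendsto (fun Z : CBS.Partition t => M.centredLogSum u Z) (CBS.fine t) (𝓝 (c t))) ∧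
        M.IsAdditiveCocycle b ∧
        M.IsCentredAdditiveCocycle c ∧
        (∀ t : ℝ≥0, b t = c t + ((t : ℝ) : ℂ) • (K * M.e₀)) ∧
        M.expect (b 1) = K * M.e₀ ∧
        (∀ (c' : ℝ≥0 → H →L[ℂ] H) (K' : H →L[ℂ] H), M.IsCentredAdditiveCocycle c' → K' ∈ M.alg₀ →
          (∀ t : ℝ≥0, b t = c' t + ((t : ℝ) : ℂ) • (K' * M.e₀)) → c' = c ∧ K' = K) ∧
        M.StructureEquation b ∧
        (∀ t : ℝ≥0, CBS.inner₀ (b t - M.expect (b t)) (b t - M.expect (b t))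
          + ((t : ℝ) : ℂ) • star (M.expect (b 1)) + ((t : ℝ) : ℂ) • M.expect (b 1) = 0) ∧
        (∀ t : ℝ≥0, CBS.inner₀ (c t) (c t) + ((t : ℝ) : ℂ) • ((star K + K) * M.e₀) = 0) := by
  obtain ⟨K, hK, hα, hαe, hαn⟩ := CBS.BernoulliShift.exists_expect_eq_exp hu hcont
  obtain ⟨hsq, hstr, hadd⟩ := CBS.BernoulliShift.centredPart_estimates hu hα hαe hαn
  have hvm := CBS.BernoulliShift.centredPart_mem hu
  have hvc : ∀ ξ, Continuous fun t => M.centredPart u t ξ := fun ξ =>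
    (ContinuousLinearMap.apply ℂ H ξ).continuous.comp (hcont.sub (hcont.const_mul M.e₀))
  obtain ⟨c, hcm, hcadd, C, hC, hcv⟩ :=
    CBS.BernoulliShift.exists_additive hvm hvc (by positivity) hadd
  have hsqrt : ∀ t : ℝ≥0, ‖M.centredPart u t‖ ≤ Real.sqrt (2 * ‖K‖ * t) := fun t =>
    Real.le_sqrt_of_sq_le (hsq t)
  have hc0 : ∀ t, M.e₀ * c t = 0 := fun t => (CBS.BernoulliShift.mem_centred.1 (hcm t)).2
  have hcc : Continuous c := by
    refine CBS.BernoulliShift.continuous_of_additive hcadd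
      (φ := fun t => C * t + Real.sqrt (2 * ‖K‖ * t)) ?_ fun t => ?_
    · have h1 : Continuous fun t : ℝ => C * t + Real.sqrt (2 * ‖K‖ * t) := by fun_prop
      simpa using h1.tendsto 0
    · have := norm_add_le (c t - M.centredPart u t) (M.centredPart u t)
      rw [sub_add_cancel] at this
      linarith [hcv t, hsqrt t]
  have hcstr := CBS.BernoulliShift.star_mul_add_eq_zero hcm hcadd hC hcv hsqrt hstr
  have hcsum := CBS.BernoulliShift.tendsto_riemann_sum hcm hvm hcadd hcv
  set b : ℝ≥0 → H →L[ℂ] H := fun t => c t + ((t : ℝ) : ℂ) • (K * M.e₀) with hb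
  have hbe : ∀ t, M.expect (b t) = ((t : ℝ) : ℂ) • (K * M.e₀) := by
    intro t
    rw [M.expect_eq, hb]
    simp only
    rw [mul_add, hc0, zero_add, mul_smul_comm, M.commute_e₀ hK, ← mul_assoc, M.e₀_mul_e₀]
  have hbe1 : M.expect (b 1) = K * M.e₀ := by
    rw [hbe]; simp
  have hbc : ∀ t, b t - M.expect (b t) = c t := fun t => by
    rw [hbe, hb]; simp
  have hstar : star (K * M.e₀) = star K * M.e₀ := by
    rw [star_mul, M.star_e₀, M.commute_e₀ (star_mem hK)]
  have hstr2 : ∀ t : ℝ≥0, CBS.inner₀ (b t - M.expect (b t)) (b t - M.expect (b t))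
      + ((t : ℝ) : ℂ) • star (M.expect (b 1)) + ((t : ℝ) : ℂ) • M.expect (b 1) = 0 := by
    intro t
    rw [hbc, hbe1, hstar, CBS.inner₀, add_assoc, ← smul_add, ← add_mul]
    exact hcstr t
  have hcadapted : CBS.BernoulliShift.IsAdditiveCocycle M c :=
    ⟨hcc, fun t => M.mem_bimodule.1 (CBS.BernoulliShift.mem_centred.1 (hcm t)).1,
      fun s t => hcadd t s⟩
  refine ⟨K, hK, fun t => by rw [M.expect_eq, hαe], fun t => hαn t t.coe_nonneg, b, c,
    fun t => ?_, fun t => ?_, ⟨?_, fun t => ?_, fun s t => ?_⟩, ⟨hcadapted, fun t => ?_⟩,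
    fun t => rfl, hbe1, ?_, fun t => ?_, hstr2, fun t => ?_⟩
  · -- the Riemann sums for `b` and `c` differ by those of the function `A - 1`
    have h1 : Tendsto (fun Z : CBS.Partition t => ∑ i, (M.expect (u (Z.step i)) - M.e₀))
        (CBS.fine t) (𝓝 (((t : ℝ) : ℂ) • (K * M.e₀))) := by
      rw [tendsto_iff_norm_sub_tendsto_zero]
      have h2 : Tendsto (fun Z : CBS.Partition t => ‖K‖ ^ 2 * (Z.mesh * t)) (CBS.fine t)
          (𝓝 0) := by
        simpa using ((CBS.tendsto_mesh t).mul_const (t : ℝ)).const_mul (‖K‖ ^ 2)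
      refine squeeze_zero (fun _ => norm_nonneg _) (fun Z => ?_) h2
      have h3 : (∑ i, (M.expect (u (Z.step i)) - M.e₀)) - ((t : ℝ) : ℂ) • (K * M.e₀) =
          ∑ i, (NormedSpace.exp (((Z.step i : ℝ) : ℂ) • K) - 1 -
            ((Z.step i : ℝ) : ℂ) • K) * M.e₀ := by
        conv_lhs => rw [← Z.sum_step]
        push_cast
        rw [Finset.sum_smul, ← Finset.sum_sub_distrib]
        refine Finset.sum_congr rfl fun i _ => ?_
        rw [M.expect_eq, ← hαe, sub_mul, sub_mul, one_mul, smul_mul_assoc]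
      rw [h3]
      refine (norm_sum_le _ _).trans ?_
      refine le_trans ?_ (mul_le_mul_of_nonneg_left Z.sum_step_sq_le (sq_nonneg ‖K‖))
      rw [Finset.mul_sum]
      refine Finset.sum_le_sum fun i _ => ?_
      refine (norm_mul_le _ _).trans
        ((mul_le_of_le_one_right (norm_nonneg _) M.norm_e₀_le).trans ?_)
      exact CBS.norm_exp_smul_sub_one_sub_le hαn (Z.step i).coe_nonneg
    refine ((hcsum t).add h1).congr fun Z => ?_
    rw [CBS.BernoulliShift.logSum, ← Finset.sum_add_distrib]
    refine Finset.sum_congr rfl fun i _ => ?_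
    have h2 : M.expect (u (Z.step i)) - M.e₀ =
        M.shift (Z.pt i.castSucc) (M.expect (u (Z.step i)) - M.e₀) := by
      rw [M.expect_eq, ← hαe, M.shift_sub, CBS.BernoulliShift.shift_mul_e₀ _ (hα _),
        CBS.BernoulliShift.shift, M.U_mul_e₀]
    rw [h2, ← M.shift_add, CBS.BernoulliShift.centredPart, M.expect_eq]
    congr 1
    abel
  · refine (hcsum t).congr fun Z => ?_
    refine Finset.sum_congr rfl fun i _ => ?_
    rw [CBS.BernoulliShift.centredPart, M.expect_eq]
  · exact hcc.add (by fun_prop)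
  · refine M.mem_bimodule.1 (add_mem (M.mem_bimodule.2 (hcadapted.adapted t))
      (Submodule.smul_mem _ _ (CBS.ExpectedSpace.mul_e₀_mem_bimodule
        (M.alg₀_subset_F Set.ordConnected_Icc hK))))
  · have h1 : M.shift t (((s : ℝ) : ℂ) • (K * M.e₀)) = ((s : ℝ) : ℂ) • (K * M.e₀) := by
      conv_rhs => rw [← CBS.BernoulliShift.shift_mul_e₀ t hK]
      rw [CBS.BernoulliShift.shift, mul_smul_comm]
      rfl
    rw [hb]
    simp only
    rw [hcadd, M.shift_add, h1]
    push_cast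
    rw [add_smul]
    abel
  · rw [M.expect_eq, hc0]
  · intro c' K' hc' hK' hbc'
    have h1 : K' = K := by
      refine M.eq_of_mul_gnsProj_eq M.alg₀_subset hK' hK ?_
      have h2 := hbc' 1
      have h3 := hc'.2 1
      rw [M.expect_eq] at h3
      have h4 : M.expect (b 1) = K' * M.e₀ := by
        rw [h2, M.expect_eq, mul_add, h3, M.commute_e₀ hK']
        simp [← mul_assoc, M.e₀_mul_e₀]
      rw [← CBS.ExpectedSpace.e₀_eq_gnsProj, ← h4, hbe1]
    refine ⟨?_, h1⟩
    funext t
    have h2 := hbc' t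
    rw [h1] at h2
    exact (add_right_cancel h2).symm
  · have h1 := hstr2 t
    rw [hbe1] at h1
    rw [hbe t, hb] at *
    simp only [add_sub_cancel_right] at h1 ⊢
    rw [star_smul, Complex.star_def, Complex.conj_ofReal, add_right_comm]
    exact h1
  · exact hcstr t
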